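/- **Quantum Laplace Transform.** For $n\ge 1$ and $N=2^n$, an $(n+a)$-qubit unitary $U$ is an $(\alpha,a,\epsilon)$-block-encoding of an $n$-qubit operator $A$ if $\|A-\alpha(\langle 0|^{\otimes a}\otimes I_n)U(|0\rangle^{\otimes a}\otimes I_n)\|\le\epsilon$ in spectral norm. Let $a_{be}\in\mathbb N$, $\epsilon\in(0,1)$, $x,y\in\mathbb R^N$, $x_{\max}=\max_i|x_i|>0$, $y_{\max}=\max_j|y_j|>0$, and let $\mathrm{QLT}=(e^{x_iy_j}/N)_{i,j}$. Put $$E=x_{\max}y_{\max}+\frac{\ln(1/\epsilon)}{\ln\left(e+\frac{\ln(1/\epsilon)}{x_{\max}y_{\max}}\right)},\qquad I_{k,\max}=\frac{e^{x_{\max}y_{\max}}(x_{\max}y_{\max}/2)^k}{k!},$$ let $I_k$ be the modified Bessel function of the first kind and $T_k$ the Chebyshev polynomial of the first kind, and define the diagonal $n$-qubit operators $$X_k=\sum_i\Big(\frac{x_i}{x_{\max}}\Big)^k|i\rangle\langle i|,\quad Y_k=\sum_j\Big(\frac{y_j}{y_{\max}}\Big)^k|j\rangle\langle j|,\quad \mathcal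 I_k=\sum_i\frac{I_k(y_{\max}x_i)}{I_{k,\max}}|i\rangle\langle i|,\quad \mathcal T_k=\sum_jT_k\Big(\frac{y_j}{y_{\max}}\Big)|j\rangle\langle j| .$$ There are absolute constants $c_1,c_2,C>0$ and $p\in\mathbb N$ such that for all such $n,a_{be},\epsilon,x,y$ the following holds in each of the two cases * (Taylor expansion) $\alpha=e^{x_{\max}y_{\max}}$, $(D_k,D'_k)=(X_k,Y_k)$; * (Chebyshev expansion) $\alpha=e^{x_{\max}y_{\max}}\left(2e^{x_{\max}y_{\max}/2}-1\right)$, $(D_k,D'_k)=(\mathcal I_k,\mathcal T_k)$. There is an integer $K\ge1$ with $c_1E\le K\le c_2E+1$ (that is, $K=\Theta(E)$ up to rounding up to an integer) and a quantum circuit on $n+\big(2n+2a_{be}+\lceil\log_2(K+1)\rceil\big)$ qubits which consists of * at most $CK$ one-controlled black-box operators $C(U_k)$, $C(V_k)$, $0\le k\le K$, each $U_k$ and $V_k$ acting on $n+a_{be}$ qubits, and * an additional circuit of one- and two-qubit gates of size (number of gates) at most $C\,nK(1+\ln K)^p$ and depth (number of layers of gates acting on disjoint qubits) at most $C\,(1+\ln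 n)K(1+\ln K)^p$, i.e. of size $\tilde O(nK)$ and depth $\tilde O(K\log n)$, where $\tilde O$ hides factors polylogarithmic in $K$, such that, whenever $U_k$ and $V_k$ are $(1,a_{be},\epsilon/(6\alpha))$-block-encodings of $D_k$ and $D'_k$ for all $0\le k\le K$, the circuit implements an $(\alpha,\,2n+2a_{be}+\lceil\log_2(K+1)\rceil,\,\epsilon)$-block-encoding of $\mathrm{QLT}$. -/

import Mathlib

/-!  ### Qubit operators -/

/-- Labels of the computational basis of a register of `q` qubits. -/
abbrev QubitBasis (q : ℕ) : Type := Fin q → Fin 2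

/-- Operators on `q` qubits, as complex matrices in the computational basis. -/
abbrev QubitOp (q : ℕ) : Type := Matrix (QubitBasis q) (QubitBasis q) ℂ

/-- The basis label of `|0⟩^{⊗ a} ⊗ |i⟩`, where the integer `i < 2 ^ n` is written in binary on the
last `n` qubits: `i = ∑ l, i_l * 2 ^ l`. -/
def zeroAncillaLabel (a n : ℕ) (i : Fin (2 ^ n)) : QubitBasis (a + n) :=
  Fin.append (fun _ : Fin a => (0 : Fin 2)) (finFunctionFinEquiv.symm i)

/-- The block `(⟨0|^{⊗ a} ⊗ I_n) U (|0⟩^{⊗ a} ⊗ I_n)`, as a `2 ^ n × 2 ^ n` matrix. -/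
def zeroBlock (a n : ℕ) (U : QubitOp (a + n)) : Matrix (Fin (2 ^ n)) (Fin (2 ^ n)) ℂ :=
  fun i j => U (zeroAncillaLabel a n i) (zeroAncillaLabel a n j)

/-- The spectral norm (operator norm for the Euclidean norm) of a complex matrix. -/
noncomputable def spectralNorm₂ {m : ℕ} (A : Matrix (Fin m) (Fin m) ℂ) : ℝ :=
  ‖Matrix.toEuclideanCLM (n := Fin m) (𝕜 := ℂ) A‖

/-- `U` is an `(α, a, ε)`-block-encoding of the `n`-qubit operator `A`. -/
def IsBlockEncoding {n : ℕ} (α : ℝ) (a : ℕ) (ε : ℝ) (U : QubitOp (a + n))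
    (A : Matrix (Fin (2 ^ n)) (Fin (2 ^ n)) ℂ) : Prop :=
  U ∈ Matrix.unitaryGroup (QubitBasis (a + n)) ℂ ∧
    spectralNorm₂ (A - (α : ℂ) • zeroBlock a n U) ≤ ε

/-- The operator on `q` qubits that acts as `M` on the `m` distinct wires `w 0, …, w (m - 1)` and as
the identity on all the other wires. -/
noncomputable def applyOnWires {m q : ℕ} (w : Fin m ↪ Fin q) (M : QubitOp m) : QubitOp q :=
  open Classical in
  fun s t => if ∀ i, i ∉ Set.range w → s i = t i then M (s ∘ w) (t ∘ w) else 0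

/-- The one-controlled operator `C(U) = |0⟩⟨0| ⊗ I + |1⟩⟨1| ⊗ U`; the control is the first qubit. -/
def controlled {m : ℕ} (U : QubitOp m) : QubitOp (m + 1) :=
  fun s t =>
    if s 0 = t 0 then
      (if s 0 = 1 then U (Fin.tail s) (Fin.tail t) else (1 : QubitOp m) (Fin.tail s) (Fin.tail t))
    else 0

/-!  ### Quantum circuits with access to controlled black-box operators -/

/-- A primitive gate on a register of `q` qubits: an arbitrary one- or two-qubit unitary together
with the (distinct) wires it acts on. -/
structure PrimitiveGate (q : ℕ) where
  arity : ℕ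
  arity_eq : arity = 1 ∨ arity = 2
  wires : Fin arity ↪ Fin q
  op : QubitOp arity
  op_unitary : op ∈ Matrix.unitaryGroup (QubitBasis arity) ℂ

/-- The action of a primitive gate on the whole register. -/
noncomputable def PrimitiveGate.toOp {q : ℕ} (g : PrimitiveGate q) : QubitOp q :=
  applyOnWires g.wires g.op

/-- One time step of a circuit on `q` qubits with black boxes `U_o` (`o : ι`) acting on `m` qubits:
either one layer of primitive gates acting on pairwise disjoint sets of wires,
or one application of the one-controlled operator `C(U_o)` to `m + 1` distinct wires. -/
inductive CircuitStep (q m : ℕ) (ι : Type) : Type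
  | layer (gates : List (PrimitiveGate q))
      (parallel : gates.Pairwise fun g g' => Disjoint (Set.range g.wires) (Set.range g'.wires))
  | call (o : ι) (wires : Fin (m + 1) ↪ Fin q)

/-- The operator performed by a time step, once the black boxes are given. -/
noncomputable def CircuitStep.toOp {q m : ℕ} {ι : Type} (U : ι → QubitOp m) :
    CircuitStep q m ι → QubitOp q
  | .layer gates _ => (gates.map PrimitiveGate.toOp).prod
  | .call o wires => applyOnWires wires (controlled (U o))

/-- Number of primitive gates in a time step. -/
def CircuitStep.size {q m : ℕ} {ι : Type} : CircuitStep q m ι → ℕ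
  | .layer gates _ => gates.length
  | .call _ _ => 0

/-- A layer of primitive gates counts `1` in the depth of the additional circuit. -/
def CircuitStep.depth {q m : ℕ} {ι : Type} : CircuitStep q m ι → ℕ
  | .layer _ _ => 1
  | .call _ _ => 0

/-- Number of one-controlled black-box operators in a time step. -/
def CircuitStep.calls {q m : ℕ} {ι : Type} : CircuitStep q m ι → ℕ
  | .layer _ _ => 0
  | .call _ _ => 1

/-- A circuit: a list of time steps, performed from left to right. -/
abbrev QCircuit (q m : ℕ) (ι : Type) : Type := List (CircuitStep q m ι)

/-- The operator performed by a circuit, once the black boxes are given. -/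
noncomputable def QCircuit.toOp {q m : ℕ} {ι : Type} (U : ι → QubitOp m) :
    QCircuit q m ι → QubitOp q
  | [] => 1
  | s :: c => QCircuit.toOp U c * s.toOp U

/-- Size of the additional circuit: the total number of primitive gates. -/
def QCircuit.size {q m : ℕ} {ι : Type} (c : QCircuit q m ι) : ℕ :=
  (c.map CircuitStep.size).sum

/-- Depth of the additional circuit: the total number of layers of primitive gates. -/
def QCircuit.depth {q m : ℕ} {ι : Type} (c : QCircuit q m ι) : ℕ :=
  (c.map CircuitStep.depth).sum

/-- Total number of one-controlled black-box operators. -/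
def QCircuit.calls {q m : ℕ} {ι : Type} (c : QCircuit q m ι) : ℕ :=
  (c.map CircuitStep.calls).sum

/-!  ### The discrete Laplace transform and its diagonal operators -/

/-- `max_i |v_i|`. -/
noncomputable def maxAbs {N : ℕ} (v : Fin N → ℝ) : ℝ := ⨆ i, |v i|

/-- The matrix `(e^{x_i y_j} / N)_{i,j}` with `N = 2 ^ n`. -/
noncomputable def qlt {n : ℕ} (x y : Fin (2 ^ n) → ℝ) : Matrix (Fin (2 ^ n)) (Fin (2 ^ n)) ℂ :=
  Matrix.of fun i j => ((Real.exp (x i * y j) / (2 : ℝ) ^ n : ℝ) : ℂ)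

/-- The real diagonal operator `∑ i, d_i |i⟩⟨i|`. -/
noncomputable def diagOp {N : ℕ} (d : Fin N → ℝ) : Matrix (Fin N) (Fin N) ℂ :=
  Matrix.diagonal fun i => (d i : ℂ)

/-- `∑ i, (v_i / v_max) ^ k |i⟩⟨i|`, the diagonal operators of the Taylor expansion. -/
noncomputable def powerDiag {N : ℕ} (v : Fin N → ℝ) (k : ℕ) : Matrix (Fin N) (Fin N) ℂ :=
  diagOp fun i => (v i / maxAbs v) ^ k

/-- The modified Bessel function of the first kind of integer order `k`,
`I_k(z) = ∑_{m ≥ 0} (z / 2) ^ (2 m + k) / (m! (m + k)!)`. -/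
noncomputable def besselI (k : ℕ) (z : ℝ) : ℝ :=
  ∑' m : ℕ, (z / 2) ^ (2 * m + k) / ((m.factorial : ℝ) * ((m + k).factorial : ℝ))

/-- The series defining `I_k(z)` converges for every real `z`. -/
theorem summable_besselI (k : ℕ) (z : ℝ) :
    Summable fun m : ℕ =>
      (z / 2) ^ (2 * m + k) / ((m.factorial : ℝ) * ((m + k).factorial : ℝ)) := by
  have h := (Real.summable_pow_div_factorial ((z / 2) ^ 2)).mul_left (|z / 2| ^ k)
  refine Summable.of_norm_bounded h fun m => ?_
  have h1 : (0 : ℝ) < (m.factorial : ℝ) := by exact_mod_cast m.factorial_pos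
  have h2 : (1 : ℝ) ≤ ((m + k).factorial : ℝ) := by exact_mod_cast (m + k).factorial_pos
  rw [Real.norm_eq_abs, abs_div, abs_pow, abs_of_pos (by positivity :
    (0 : ℝ) < (m.factorial : ℝ) * ((m + k).factorial : ℝ)), pow_add, pow_mul, sq_abs, mul_comm,
    ← mul_div_assoc]
  exact div_le_div_of_nonneg_left (by positivity) h1 (le_mul_of_one_le_right h1.le h2)

/-- `I_{k,max} = e^{x_max y_max} (x_max y_max / 2) ^ k / k!`. -/
noncomputable def besselBound {N : ℕ} (x y : Fin N → ℝ) (k : ℕ) : ℝ :=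
  Real.exp (maxAbs x * maxAbs y) * (maxAbs x * maxAbs y / 2) ^ k / (k.factorial : ℝ)

/-- `∑ i, I_k(y_max x_i) / I_{k,max} |i⟩⟨i|`. -/
noncomputable def besselDiag {N : ℕ} (x y : Fin N → ℝ) (k : ℕ) : Matrix (Fin N) (Fin N) ℂ :=
  diagOp fun i => besselI k (maxAbs y * x i) / besselBound x y k

/-- `∑ j, T_k(y_j / y_max) |j⟩⟨j|`, with `T_k` the Chebyshev polynomials of the first kind. -/
noncomputable def chebyshevDiag {N : ℕ} (y : Fin N → ℝ) (k : ℕ) : Matrix (Fin N) (Fin N) ℂ :=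
  diagOp fun j => (Polynomial.Chebyshev.T ℝ (k : ℤ)).eval (y j / maxAbs y)

/-- `x_max y_max + ln(1/ε) / ln(e + ln(1/ε) / (x_max y_max))`. -/
noncomputable def truncationScale {N : ℕ} (x y : Fin N → ℝ) (ε : ℝ) : ℝ :=
  maxAbs x * maxAbs y +
    Real.log (1 / ε) / Real.log (Real.exp 1 + Real.log (1 / ε) / (maxAbs x * maxAbs y))

/-- The `n`-qubit operator `A` can be `(α, 2n + 2a + ⌈log₂(K+1)⌉, ε)`-block-encoded by a circuit
which uses at most `C * K` one-controlled black boxes `C(U_k)`, `C(V_k)` (`k = 0, …, K`) and, besides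
these, at most `C * n * K * (1 + ln K) ^ p` primitive gates arranged in at most
`C * (1 + ln n) * K * (1 + ln K) ^ p` layers. The block-encoding property holds for all choices of
`(1, a, ε / (6 α))`-block-encodings `U_k` of `D k` and `V_k` of `D' k`. -/
def BlockEncodableFromDiagonals {n : ℕ} (a K : ℕ) (α ε C : ℝ) (p : ℕ)
    (D D' : ℕ → Matrix (Fin (2 ^ n)) (Fin (2 ^ n)) ℂ)
    (A : Matrix (Fin (2 ^ n)) (Fin (2 ^ n)) ℂ) : Prop :=
  ∃ c : QCircuit ((2 * n + 2 * a + Nat.clog 2 (K + 1)) + n) (a + n) (Fin (K + 1) ⊕ Fin (K + 1)),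
    (c.calls : ℝ) ≤ C * K ∧
    (c.size : ℝ) ≤ C * (n * K) * (1 + Real.log K) ^ p ∧
    (c.depth : ℝ) ≤ C * ((1 + Real.log n) * K) * (1 + Real.log K) ^ p ∧
    ∀ U V : Fin (K + 1) → QubitOp (a + n),
      (∀ k, IsBlockEncoding 1 a (ε / (6 * α)) (U k) (D k)) →
      (∀ k, IsBlockEncoding 1 a (ε / (6 * α)) (V k) (D' k)) →
      IsBlockEncoding α (2 * n + 2 * a + Nat.clog 2 (K + 1)) ε (c.toOp (Sum.elim U V)) A

/-! Write `z = maxAbs x * maxAbs y` and let `J = uniformProjection n` be the matrix with all entries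
`1 / 2 ^ n`, the projection on the uniform superposition. A kernel expansion `exp (x i * y j) = ∑ k,
c k * d k i * d' k j` with `c k ≥ 0` and `|d|, |d'| ≤ 1` reads `QLT = ∑ k, c k • D k * J * D' k`
with diagonal contractions `D k`, `D' k`. The exponential series gives the Taylor case. The
Jacobi-Anger series with `cos θ = y j / maxAbs y` gives the Chebyshev case (`hasSum_jacobi_anger`,
`abs_besselI_le`). In both, `α = ∑ k, c k`.

The sum is realized as a linear combination of unitaries `P† * SELECT_U * layer * SELECT_V * P`.
Here `P` puts amplitudes `√(p k)` on an index register (`exists_preparation`), SELECT applies the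
`k`-th black box on index `k` (`CircuitRealizable.select`), and one layer of `n` two-qubit gates
between the system and `n` fresh ancillas has zero block `J` (`projectionGates_apply`). The two
families of black boxes have separate ancillas, so the zero block of the product is the product of
the zero blocks (`select_project_select_apply`). Multi-controlled gates are built without ancillas
as group commutators, at a cost quadratic in the number `l = O(log K)` of controls. This gives `O(n
+ K l ^ 2)` gates and `O(K l ^ 2)` layers.

The weights are `p k = c k / α` for `k < K`, and `p K` takes all that remains. They sum to `1`, so
the scale is exactly `α`. With `T = α - ∑ k ≤ K, c k`, truncation costs `2 * T ≤ 2 * ε / 3`, and the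
inexact black boxes cost `α * 2 * ε / (6 * α) = ε / 3` (`norm_sub_truncated_le`). Finally `T ≤ ε /
3` for `K = ⌊16 E⌋ + 1`, `E` the truncation scale, by the bound `m! ≥ (m / e) ^ m`
(`tail_le_of_truncation`). -/

open scoped Matrix

/-! ### Multiplexed operators -/

/-- Two basis labels agree on all the wires which are not in the range of `w`. -/
def AgreeOff {m q : ℕ} (w : Fin m → Fin q) (s t : QubitBasis q) : Prop :=
  ∀ i, i ∉ Set.range w → s i = t i

theorem AgreeOff.symm {m q : ℕ} {w : Fin m → Fin q} {s t : QubitBasis q} (h : AgreeOff w s t) :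
    AgreeOff w t s := fun i hi => (h i hi).symm

theorem AgreeOff.trans {m q : ℕ} {w : Fin m → Fin q} {s t u : QubitBasis q}
    (h : AgreeOff w s t) (h' : AgreeOff w t u) : AgreeOff w s u :=
  fun i hi => (h i hi).trans (h' i hi)

theorem AgreeOff.refl {m q : ℕ} (w : Fin m → Fin q) (s : QubitBasis q) : AgreeOff w s s :=
  fun _ _ => rfl

theorem agreeOff_extend {m q : ℕ} (w : Fin m ↪ Fin q) (r : QubitBasis m) (s : QubitBasis q) :
    AgreeOff w s (Function.extend w r s) := by
  intro i hi
  rw [Function.extend_apply' _ _ _ (by simpa using hi)]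

theorem AgreeOff.extend_eq {m q : ℕ} {w : Fin m ↪ Fin q} {s t : QubitBasis q}
    (h : AgreeOff w s t) : Function.extend w (t ∘ w) s = t := by
  funext i
  by_cases hi : i ∈ Set.range w
  · obtain ⟨j, rfl⟩ := hi
    rw [w.injective.extend_apply]; rfl
  · rw [Function.extend_apply' _ _ _ (by simpa using hi), h i hi]

/-- The operator which acts on the wires `w` as `F s`, where `F s` is selected by the label `s`. -/
noncomputable def mux {m q : ℕ} (w : Fin m ↪ Fin q) (F : QubitBasis q → QubitOp m) : QubitOp q :=
  open Classical in
  fun s t => if AgreeOff w s t then F s (s ∘ w) (t ∘ w) else 0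

/-- `F` does not depend on the wires `w`. -/
def IndepOf {m q : ℕ} {β : Type*} (w : Fin m → Fin q) (F : QubitBasis q → β) : Prop :=
  ∀ s t, AgreeOff w s t → F s = F t

theorem mux_const {m q : ℕ} (w : Fin m ↪ Fin q) (M : QubitOp m) :
    mux w (fun _ => M) = applyOnWires w M := by
  ext s t
  unfold mux applyOnWires AgreeOff
  split_ifs <;> rfl

theorem mux_apply_of_agree {m q : ℕ} {w : Fin m ↪ Fin q} {F : QubitBasis q → QubitOp m}
    {s t : QubitBasis q} (h : AgreeOff w s t) : mux w F s t = F s (s ∘ w) (t ∘ w) := by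
  simp [mux, h]

theorem mux_apply_of_not_agree {m q : ℕ} {w : Fin m ↪ Fin q} {F : QubitBasis q → QubitOp m}
    {s t : QubitBasis q} (h : ¬ AgreeOff w s t) : mux w F s t = 0 := by
  simp [mux, h]

theorem mux_mul_apply {m q : ℕ} (w : Fin m ↪ Fin q) (F : QubitBasis q → QubitOp m)
    (M : QubitOp q) (s u : QubitBasis q) :
    (mux w F * M) s u = ∑ r, F s (s ∘ w) r * M (Function.extend w r s) u := by
  classical
  rw [Matrix.mul_apply]
  symm
  refine Finset.sum_of_injOn (fun r => Function.extend w r s) ?_ ?_ ?_ ?_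
  · exact (Function.extend_injective w.injective s).injOn
  · simp [Set.MapsTo]
  · intro t _ ht
    rw [mux_apply_of_not_agree, zero_mul]
    intro h
    exact ht ⟨t ∘ w, by simp, h.extend_eq⟩
  · intro r _
    rw [mux_apply_of_agree (agreeOff_extend w r s), Function.extend_comp w.injective]

theorem mul_mux_apply {m q : ℕ} (w : Fin m ↪ Fin q) {F : QubitBasis q → QubitOp m}
    (hF : IndepOf w F) (M : QubitOp q) (s u : QubitBasis q) :
    (M * mux w F) s u = ∑ r, M s (Function.extend w r u) * F u r (u ∘ w) := by
  classical
  rw [Matrix.mul_apply]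
  symm
  refine Finset.sum_of_injOn (fun r => Function.extend w r u) ?_ ?_ ?_ ?_
  · exact (Function.extend_injective w.injective u).injOn
  · simp [Set.MapsTo]
  · intro t _ ht
    rw [mux_apply_of_not_agree, mul_zero]
    intro h
    exact ht ⟨t ∘ w, by simp, h.symm.extend_eq⟩
  · intro r _
    rw [mux_apply_of_agree (agreeOff_extend w r u).symm, Function.extend_comp w.injective,
      hF _ _ (agreeOff_extend w r u)]

/-- The intermediate label differs from `s` only on `w`, which the selector `F'` does not see, so
both factors are selected by the same label. This reduces products of controlled gates to pointwise
identities. -/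
theorem mux_mul_mux {m q : ℕ} (w : Fin m ↪ Fin q) (F : QubitBasis q → QubitOp m)
    {F' : QubitBasis q → QubitOp m} (hF' : IndepOf w F') :
    mux w F * mux w F' = mux w (fun s => F s * F' s) := by
  ext s u
  rw [mux_mul_apply]
  by_cases h : AgreeOff w s u
  · rw [mux_apply_of_agree h, Matrix.mul_apply]
    refine Finset.sum_congr rfl fun r _ => ?_
    rw [mux_apply_of_agree ((agreeOff_extend w r s).symm.trans h),
      Function.extend_comp w.injective, hF' _ _ (agreeOff_extend w r s)]
  · rw [mux_apply_of_not_agree h]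
    refine Finset.sum_eq_zero fun r _ => ?_
    rw [mux_apply_of_not_agree, mul_zero]
    exact fun h' => h ((agreeOff_extend w r s).trans h')

theorem mux_one {m q : ℕ} (w : Fin m ↪ Fin q) : mux w (fun _ => 1) = 1 := by
  ext s u
  by_cases h : AgreeOff w s u
  · rw [mux_apply_of_agree h, Matrix.one_apply, Matrix.one_apply]
    refine if_congr ⟨fun h' => ?_, fun h' => by rw [h']⟩ rfl rfl
    rw [← h.extend_eq, ← h', (AgreeOff.refl w s).extend_eq]
  · rw [mux_apply_of_not_agree h, Matrix.one_apply_ne]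
    rintro rfl
    exact h (AgreeOff.refl w s)

theorem conjTranspose_mux {m q : ℕ} (w : Fin m ↪ Fin q) {F : QubitBasis q → QubitOp m}
    (hF : IndepOf w F) : (mux w F).conjTranspose = mux w (fun s => (F s).conjTranspose) := by
  ext s u
  rw [Matrix.conjTranspose_apply]
  by_cases h : AgreeOff w s u
  · rw [mux_apply_of_agree h, mux_apply_of_agree h.symm, Matrix.conjTranspose_apply, hF _ _ h]
  · rw [mux_apply_of_not_agree h, mux_apply_of_not_agree fun h' => h h'.symm, star_zero]

theorem mux_mem_unitaryGroup {m q : ℕ} (w : Fin m ↪ Fin q) {F : QubitBasis q → QubitOp m}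
    (hF : IndepOf w F) (hU : ∀ s, F s ∈ Matrix.unitaryGroup (QubitBasis m) ℂ) :
    mux w F ∈ Matrix.unitaryGroup (QubitBasis q) ℂ := by
  rw [Matrix.mem_unitaryGroup_iff, Matrix.star_eq_conjTranspose, conjTranspose_mux w hF,
    mux_mul_mux w F fun s t h => by rw [hF s t h]]
  simp_rw [← Matrix.star_eq_conjTranspose, Matrix.mem_unitaryGroup_iff.1 (hU _)]
  exact mux_one w

theorem indepOf_const {m q : ℕ} {β : Type*} (w : Fin m → Fin q) (b : β) :
    IndepOf w (fun _ => b) := fun _ _ _ => rfl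

theorem applyOnWires_mem_unitaryGroup {m q : ℕ} (w : Fin m ↪ Fin q) {M : QubitOp m}
    (hM : M ∈ Matrix.unitaryGroup (QubitBasis m) ℂ) :
    applyOnWires w M ∈ Matrix.unitaryGroup (QubitBasis q) ℂ := by
  rw [← mux_const]
  exact mux_mem_unitaryGroup w (indepOf_const _ M) fun _ => hM

/-! ### Controlled operators -/

/-- The operator which acts as `M` on the last `m` qubits if the first one is in the state `b`. -/
def controlledOn {m : ℕ} (b : Fin 2) (M : QubitOp m) : QubitOp (m + 1) :=
  fun s t =>
    if s 0 = t 0 then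
      (if s 0 = b then M (Fin.tail s) (Fin.tail t) else (1 : QubitOp m) (Fin.tail s) (Fin.tail t))
    else 0

/-- The wires `c, w 0, w 1, …`. -/
def consWires {m q : ℕ} (c : Fin q) (w : Fin m ↪ Fin q) (hc : c ∉ Set.range w) :
    Fin (m + 1) ↪ Fin q :=
  ⟨Fin.cons c w, Fin.cons_injective_iff.2 ⟨hc, w.injective⟩⟩

theorem range_consWires {m q : ℕ} (c : Fin q) (w : Fin m ↪ Fin q) (hc : c ∉ Set.range w) :
    Set.range (consWires c w hc) = insert c (Set.range w) :=
  Fin.range_cons c w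

theorem applyOnWires_controlledOn {m q : ℕ} (c : Fin q) (w : Fin m ↪ Fin q)
    (hc : c ∉ Set.range w) (b : Fin 2) (M : QubitOp m) :
    applyOnWires (consWires c w hc) (controlledOn b M) =
      mux w (fun s => if s c = b then M else 1) := by
  ext s t
  have h0 : ∀ s : QubitBasis q, (s ∘ consWires c w hc) 0 = s c := fun s => rfl
  have h1 : ∀ s : QubitBasis q, Fin.tail (s ∘ consWires c w hc) = s ∘ w := fun s => rfl
  rw [← mux_const]
  by_cases h : AgreeOff w s t
  · have hst : s c = t c := h c hc
    rw [mux_apply_of_agree h, mux_apply_of_agree]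
    · simp only [controlledOn, h0, h1, hst, if_true]
      split_ifs <;> rfl
    · intro i hi
      refine h i fun h' => hi ?_
      rw [range_consWires]; exact Or.inr h'
  · rw [mux_apply_of_not_agree h]
    by_cases h' : AgreeOff (consWires c w hc) s t
    · rw [mux_apply_of_agree h', controlledOn, h0, h0, if_neg]
      intro hst
      refine h fun i hi => ?_
      by_cases hic : i = c
      · rw [hic, hst]
      · refine h' i ?_
        rw [range_consWires]
        exact fun h'' => h''.elim hic hi
    · rw [mux_apply_of_not_agree h']

theorem controlledOn_mem_unitaryGroup {m : ℕ} (b : Fin 2) {M : QubitOp m}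
    (hM : M ∈ Matrix.unitaryGroup (QubitBasis m) ℂ) :
    controlledOn b M ∈ Matrix.unitaryGroup (QubitBasis (m + 1)) ℂ := by
  have h0 : (0 : Fin (m + 1)) ∉ Set.range (Fin.succEmb m) := by
    rintro ⟨i, hi⟩
    exact Fin.succ_ne_zero i hi
  have h := applyOnWires_controlledOn 0 (Fin.succEmb m) h0 b M
  -- On the full register `0, 1, …, m` this wiring is the identity, so unitarity follows from that
  -- of a multiplexed operator.
  have hid : ∀ s : QubitBasis (m + 1), s ∘ consWires 0 (Fin.succEmb m) h0 = s := by
    intro s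
    funext i
    refine Fin.cases rfl (fun j => rfl) i
  have : applyOnWires (consWires 0 (Fin.succEmb m) h0) (controlledOn b M) = controlledOn b M := by
    ext s t
    rw [← mux_const, mux_apply_of_agree, hid, hid]
    intro i hi
    refine absurd ?_ hi
    rw [range_consWires]
    refine Fin.cases (Or.inl rfl) (fun j => Or.inr ⟨j, rfl⟩) i
  rw [← this, h]
  refine mux_mem_unitaryGroup _ (fun s t hst => by rw [hst 0 h0]) fun s => ?_
  split_ifs
  exacts [hM, one_mem _]

/-! ### Unitarity of circuits -/

theorem PrimitiveGate.toOp_mem_unitaryGroup {q : ℕ} (g : PrimitiveGate q) :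
    g.toOp ∈ Matrix.unitaryGroup (QubitBasis q) ℂ :=
  applyOnWires_mem_unitaryGroup _ g.op_unitary

theorem CircuitStep.toOp_mem_unitaryGroup {q m : ℕ} {ι : Type} {U : ι → QubitOp m}
    (hU : ∀ o, U o ∈ Matrix.unitaryGroup (QubitBasis m) ℂ) (s : CircuitStep q m ι) :
    s.toOp U ∈ Matrix.unitaryGroup (QubitBasis q) ℂ := by
  cases s with
  | layer gates _ =>
    refine Submonoid.list_prod_mem _ fun M hM => ?_
    obtain ⟨g, _, rfl⟩ := List.mem_map.1 hM
    exact g.toOp_mem_unitaryGroup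
  | call o wires => exact applyOnWires_mem_unitaryGroup _ (controlledOn_mem_unitaryGroup 1 (hU o))

theorem QCircuit.toOp_mem_unitaryGroup {q m : ℕ} {ι : Type} {U : ι → QubitOp m}
    (hU : ∀ o, U o ∈ Matrix.unitaryGroup (QubitBasis m) ℂ) (c : QCircuit q m ι) :
    QCircuit.toOp U c ∈ Matrix.unitaryGroup (QubitBasis q) ℂ := by
  induction c with
  | nil => exact one_mem _
  | cons s c ih => exact mul_mem ih (s.toOp_mem_unitaryGroup hU)

/-! ### Multiplexed one-qubit gates -/

/-- A `2 × 2` matrix as an operator on one qubit. -/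
def oneQubit (G : Matrix (Fin 2) (Fin 2) ℂ) : QubitOp 1 := fun s t => G (s 0) (t 0)

theorem sum_qubitBasis_one {β : Type*} [AddCommMonoid β] (F : QubitBasis 1 → β) :
    ∑ r, F r = ∑ b : Fin 2, F (fun _ => b) :=
  (Fintype.sum_equiv (Equiv.funUnique (Fin 1) (Fin 2)).symm (fun b => F (fun _ => b)) F
    fun _ => rfl).symm

theorem oneQubit_mul (G H : Matrix (Fin 2) (Fin 2) ℂ) :
    oneQubit G * oneQubit H = oneQubit (G * H) := by
  ext s t
  rw [Matrix.mul_apply, sum_qubitBasis_one]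
  simp [oneQubit, Matrix.mul_apply]

theorem oneQubit_one : oneQubit 1 = 1 := by
  ext s t
  have : s 0 = t 0 ↔ s = t :=
    ⟨fun h => funext fun i => by rw [Subsingleton.elim i 0, h], fun h => by rw [h]⟩
  simp [oneQubit, Matrix.one_apply, this]

theorem conjTranspose_oneQubit (G : Matrix (Fin 2) (Fin 2) ℂ) :
    (oneQubit G).conjTranspose = oneQubit G.conjTranspose := rfl

theorem oneQubit_mem_unitaryGroup {G : Matrix (Fin 2) (Fin 2) ℂ}
    (hG : G ∈ Matrix.unitaryGroup (Fin 2) ℂ) :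
    oneQubit G ∈ Matrix.unitaryGroup (QubitBasis 1) ℂ := by
  rw [Matrix.mem_unitaryGroup_iff, Matrix.star_eq_conjTranspose] at *
  rw [conjTranspose_oneQubit, oneQubit_mul, hG, oneQubit_one]

/-- A single wire. -/
def singleWire {q : ℕ} (t : Fin q) : Fin 1 ↪ Fin q :=
  ⟨fun _ => t, fun _ _ _ => Subsingleton.elim _ _⟩

theorem range_singleWire {q : ℕ} (t : Fin q) : Set.range (singleWire t) = {t} :=
  Set.range_const

theorem extend_singleWire {q : ℕ} (t : Fin q) (b : Fin 2) (s : QubitBasis q) :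
    Function.extend (singleWire t) (fun _ => b) s = Function.update s t b := by
  funext i
  by_cases hi : i = t
  · subst hi
    rw [Function.update_self]
    exact (singleWire i).injective.extend_apply _ _ 0
  · rw [Function.update_of_ne hi, Function.extend_apply']
    rintro ⟨_, h⟩
    exact hi h.symm

/-- The operator which acts on the wire `t` as `F s`, where `F s` is selected by the label `s`. -/
noncomputable def muxGate {q : ℕ} (t : Fin q) (F : QubitBasis q → Matrix (Fin 2) (Fin 2) ℂ) :
    QubitOp q :=
  mux (singleWire t) fun s => oneQubit (F s)

theorem muxGate_mul {q : ℕ} (t : Fin q) (F : QubitBasis q → Matrix (Fin 2) (Fin 2) ℂ)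
    {F' : QubitBasis q → Matrix (Fin 2) (Fin 2) ℂ} (hF' : IndepOf (singleWire t) F') :
    muxGate t F * muxGate t F' = muxGate t fun s => F s * F' s := by
  simp_rw [muxGate, mux_mul_mux _ _ (fun s u h => congrArg oneQubit (hF' s u h)), oneQubit_mul]

theorem muxGate_mul_apply {q : ℕ} (t : Fin q) (F : QubitBasis q → Matrix (Fin 2) (Fin 2) ℂ)
    (M : QubitOp q) (s u : QubitBasis q) :
    (muxGate t F * M) s u = ∑ b, F s (s t) b * M (Function.update s t b) u := by
  rw [muxGate, mux_mul_apply, sum_qubitBasis_one]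
  simp_rw [extend_singleWire]
  rfl

theorem mul_muxGate_apply {q : ℕ} (t : Fin q) {F : QubitBasis q → Matrix (Fin 2) (Fin 2) ℂ}
    (hF : IndepOf (singleWire t) F) (M : QubitOp q) (s u : QubitBasis q) :
    (M * muxGate t F) s u = ∑ b, M s (Function.update u t b) * F u b (u t) := by
  rw [muxGate, mul_mux_apply _ (fun s u h => congrArg oneQubit (hF s u h)), sum_qubitBasis_one]
  simp_rw [extend_singleWire]
  rfl

theorem muxGate_mulVec_single {q : ℕ} (t : Fin q)
    {F : QubitBasis q → Matrix (Fin 2) (Fin 2) ℂ}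
    (hF : IndepOf (singleWire t) F) (u : QubitBasis q) :
    muxGate t F *ᵥ Pi.single u (1 : ℂ) =
      ∑ b, F u b (u t) • Pi.single (Function.update u t b) (1 : ℂ) := by
  funext s
  have h := mul_muxGate_apply t hF 1 s u
  rw [one_mul] at h
  rw [Matrix.mulVec_single_one, Matrix.col_apply, h]
  simp [Matrix.one_apply, Pi.single_apply, mul_comm]

/-! ### Products of one- and two-qubit gates -/

/-- `M` is a product of at most `N` one- and two-qubit gates. -/
def GateRealizable {q : ℕ} (M : QubitOp q) (N : ℕ) : Prop :=
  ∃ L : List (PrimitiveGate q), L.length ≤ N ∧ (L.map PrimitiveGate.toOp).prod = M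

theorem GateRealizable.mono {q : ℕ} {M : QubitOp q} {N N' : ℕ} (h : GateRealizable M N)
    (hN : N ≤ N') : GateRealizable M N' := by
  obtain ⟨L, hL, hM⟩ := h
  exact ⟨L, hL.trans hN, hM⟩

theorem GateRealizable.one {q : ℕ} : GateRealizable (1 : QubitOp q) 0 := ⟨[], le_rfl, rfl⟩

theorem GateRealizable.mul {q : ℕ} {M M' : QubitOp q} {N N' : ℕ} (h : GateRealizable M N)
    (h' : GateRealizable M' N') : GateRealizable (M * M') (N + N') := by
  obtain ⟨L, hL, rfl⟩ := h
  obtain ⟨L', hL', rfl⟩ := h'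
  exact ⟨L ++ L', by simpa using add_le_add hL hL', by simp⟩

/-- The inverse of a primitive gate. -/
noncomputable def PrimitiveGate.adj {q : ℕ} (g : PrimitiveGate q) : PrimitiveGate q where
  arity := g.arity
  arity_eq := g.arity_eq
  wires := g.wires
  op := star g.op
  op_unitary := Unitary.star_mem g.op_unitary

theorem PrimitiveGate.toOp_adj {q : ℕ} (g : PrimitiveGate q) :
    g.adj.toOp = g.toOp.conjTranspose := by
  rw [PrimitiveGate.toOp, PrimitiveGate.toOp, ← mux_const, ← mux_const,
    conjTranspose_mux _ (indepOf_const _ _)]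
  rfl

theorem GateRealizable.conjTranspose {q : ℕ} {M : QubitOp q} {N : ℕ} (h : GateRealizable M N) :
    GateRealizable M.conjTranspose N := by
  obtain ⟨L, hL, rfl⟩ := h
  refine ⟨(L.map PrimitiveGate.adj).reverse, by simpa using hL, ?_⟩
  rw [Matrix.conjTranspose_list_prod, List.map_reverse]
  simp [Function.comp_def, PrimitiveGate.toOp_adj]

theorem GateRealizable.muxGate_one {q : ℕ} (t : Fin q) {G : Matrix (Fin 2) (Fin 2) ℂ}
    (hG : G ∈ Matrix.unitaryGroup (Fin 2) ℂ) : GateRealizable (muxGate t fun _ => G) 1 :=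
  ⟨[⟨1, Or.inl rfl, singleWire t, oneQubit G, oneQubit_mem_unitaryGroup hG⟩], le_rfl, by
    simp [PrimitiveGate.toOp, muxGate, mux_const]⟩

theorem GateRealizable.muxGate_two {q : ℕ} {c t : Fin q} (hct : c ≠ t) (b : Fin 2)
    {G : Matrix (Fin 2) (Fin 2) ℂ} (hG : G ∈ Matrix.unitaryGroup (Fin 2) ℂ) :
    GateRealizable (muxGate t fun s => if s c = b then G else 1) 1 := by
  have hc : c ∉ Set.range (singleWire t) := by rw [range_singleWire]; exact hct
  refine ⟨[⟨2, Or.inr rfl, consWires c (singleWire t) hc, controlledOn b (oneQubit G),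
    controlledOn_mem_unitaryGroup b (oneQubit_mem_unitaryGroup hG)⟩], le_rfl, ?_⟩
  simp only [List.map_cons, List.map_nil, List.prod_cons, List.prod_nil, mul_one]
  refine (applyOnWires_controlledOn c (singleWire t) hc b (oneQubit G)).trans ?_
  rw [muxGate]
  congr 1
  funext s
  split_ifs
  exacts [rfl, oneQubit_one.symm]

/-! ### Multi-controlled rotations -/

/-- Real rotations. -/
noncomputable def rotGate (θ : ℝ) : Matrix (Fin 2) (Fin 2) ℂ :=
  !![(Real.cos θ : ℂ), (Real.sin θ : ℂ); -(Real.sin θ : ℂ), (Real.cos θ : ℂ)]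

/-- Rotations of the relative phase. -/
noncomputable def phaseGate (θ : ℝ) : Matrix (Fin 2) (Fin 2) ℂ :=
  !![(Real.cos θ : ℂ) + Real.sin θ * Complex.I, 0; 0, (Real.cos θ : ℂ) - Real.sin θ * Complex.I]

theorem rotGate_mul (θ φ : ℝ) : rotGate θ * rotGate φ = rotGate (θ + φ) := by
  ext i j
  fin_cases i <;> fin_cases j <;>
    simp [rotGate, Matrix.mul_apply, Real.cos_add, Real.sin_add, -Complex.ofReal_cos,
      -Complex.ofReal_sin] <;> ring

theorem phaseGate_mul (θ φ : ℝ) : phaseGate θ * phaseGate φ = phaseGate (θ + φ) := by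
  ext i j
  fin_cases i <;> fin_cases j <;>
    simp [phaseGate, Matrix.mul_apply, Real.cos_add, Real.sin_add, -Complex.ofReal_cos,
      -Complex.ofReal_sin] <;> ring_nf <;> simp <;> ring

theorem rotGate_zero : rotGate 0 = 1 := by
  ext i j
  fin_cases i <;> fin_cases j <;> simp [rotGate]

theorem phaseGate_zero : phaseGate 0 = 1 := by
  ext i j
  fin_cases i <;> fin_cases j <;> simp [phaseGate]

theorem conjTranspose_rotGate (θ : ℝ) : (rotGate θ).conjTranspose = rotGate (-θ) := by
  ext i j
  fin_cases i <;> fin_cases j <;>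
    simp [rotGate, -Complex.ofReal_cos, -Complex.ofReal_sin]

theorem conjTranspose_phaseGate (θ : ℝ) : (phaseGate θ).conjTranspose = phaseGate (-θ) := by
  ext i j
  fin_cases i <;> fin_cases j <;>
    simp [phaseGate, -Complex.ofReal_cos, -Complex.ofReal_sin, sub_eq_add_neg]

theorem rotGate_mem_unitaryGroup (θ : ℝ) : rotGate θ ∈ Matrix.unitaryGroup (Fin 2) ℂ := by
  rw [Matrix.mem_unitaryGroup_iff, Matrix.star_eq_conjTranspose, conjTranspose_rotGate,
    rotGate_mul, add_neg_cancel, rotGate_zero]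

theorem phaseGate_mem_unitaryGroup (θ : ℝ) : phaseGate θ ∈ Matrix.unitaryGroup (Fin 2) ℂ := by
  rw [Matrix.mem_unitaryGroup_iff, Matrix.star_eq_conjTranspose, conjTranspose_phaseGate,
    phaseGate_mul, add_neg_cancel, phaseGate_zero]

/-- Conjugation by `phaseGate (π / 2)`, that is `diag (i, -i)`, changes the sign of the off-diagonal
entries and so inverts a rotation. Any rotation is thus the group commutator of a half-angle
rotation and a phase gate. The symmetric statement for phases makes the recursion close up. -/
theorem rotGate_eq_commutator (θ : ℝ) :
    rotGate θ = rotGate (θ / 2) * phaseGate (Real.pi / 2) * rotGate (-(θ / 2)) *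
      phaseGate (-(Real.pi / 2)) := by
  have h : phaseGate (Real.pi / 2) * rotGate (-(θ / 2)) * phaseGate (-(Real.pi / 2)) =
      rotGate (θ / 2) := by
    ext i j
    fin_cases i <;> fin_cases j <;>
      simp [rotGate, phaseGate, Matrix.mul_apply, -Complex.ofReal_cos, -Complex.ofReal_sin,
        -Complex.ofReal_div] <;> ring_nf <;> simp
  rw [mul_assoc, mul_assoc, ← mul_assoc (phaseGate _), h, rotGate_mul, add_halves]

theorem phaseGate_eq_commutator (θ : ℝ) :
    phaseGate θ = phaseGate (θ / 2) * rotGate (Real.pi / 2) * phaseGate (-(θ / 2)) *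
      rotGate (-(Real.pi / 2)) := by
  have h : rotGate (Real.pi / 2) * phaseGate (-(θ / 2)) * rotGate (-(Real.pi / 2)) =
      phaseGate (θ / 2) := by
    ext i j
    fin_cases i <;> fin_cases j <;>
      simp [rotGate, phaseGate, Matrix.mul_apply, -Complex.ofReal_cos, -Complex.ofReal_sin,
        -Complex.ofReal_div, sub_eq_add_neg]
  rw [mul_assoc, mul_assoc, ← mul_assoc (rotGate _), h, phaseGate_mul, add_halves]

/-- The gate `G` on the wire `t`, controlled by the wires in `A` being in the state `b`. -/
noncomputable def condGate {q : ℕ} (A : Finset (Fin q)) (b : QubitBasis q) (t : Fin q)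
    (G : Matrix (Fin 2) (Fin 2) ℂ) : QubitOp q :=
  muxGate t fun s => if ∀ i ∈ A, s i = b i then G else 1

theorem indepOf_cond {q : ℕ} {A : Finset (Fin q)} {t : Fin q} (ht : t ∉ A) (b : QubitBasis q)
    (G : Matrix (Fin 2) (Fin 2) ℂ) :
    IndepOf (singleWire t) fun s : QubitBasis q => if ∀ i ∈ A, s i = b i then G else 1 := by
  intro s u h
  refine if_congr (forall₂_congr fun i hi => ?_) rfl rfl
  rw [h i]
  rw [range_singleWire]
  rintro rfl
  exact ht hi

/-- If one of the two conditions fails, its factors become `1` and the other two cancel. The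
commutator survives only when both hold. `A` and `B` may overlap. -/
theorem condGate_union_commutator {q : ℕ} {A B : Finset (Fin q)} {t : Fin q} (hA : t ∉ A)
    (hB : t ∉ B) (b : QubitBasis q) {P P' Q Q' : Matrix (Fin 2) (Fin 2) ℂ} (hP : P * P' = 1)
    (hQ : Q * Q' = 1) :
    condGate (A ∪ B) b t (P * Q * P' * Q') =
      condGate A b t P * condGate B b t Q * condGate A b t P' * condGate B b t Q' := by
  unfold condGate
  rw [muxGate_mul _ _ (indepOf_cond hB b Q), muxGate_mul _ _ (indepOf_cond hA b P'),
    muxGate_mul _ _ (indepOf_cond hB b Q')]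
  congr 1
  funext s
  have : (∀ i ∈ A ∪ B, s i = b i) ↔ (∀ i ∈ A, s i = b i) ∧ ∀ i ∈ B, s i = b i := by
    simp only [Finset.mem_union, or_imp, forall_and]
  by_cases h1 : ∀ i ∈ A, s i = b i <;> by_cases h2 : ∀ i ∈ B, s i = b i
  · rw [if_pos (this.2 ⟨h1, h2⟩), if_pos h1, if_pos h2, if_pos h1, if_pos h2]
  · rw [if_neg (fun h => h2 (this.1 h).2), if_pos h1, if_neg h2, if_pos h1, if_neg h2]
    simp [hP]
  · rw [if_neg (fun h => h1 (this.1 h).1), if_neg h1, if_pos h2, if_neg h1, if_pos h2]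
    simp [hQ]
  · rw [if_neg (fun h => h1 (this.1 h).1), if_neg h1, if_neg h2, if_neg h1, if_neg h2]
    simp

theorem exists_union_card_le {α : Type*} [DecidableEq α] (A : Finset α) {N : ℕ}
    (hA : A.card ≤ 2 * N) : ∃ B C : Finset α, B ∪ C = A ∧ B.card ≤ N ∧ C.card ≤ N := by
  by_cases h : A.card ≤ N
  · exact ⟨A, A, Finset.union_self A, h, h⟩
  · obtain ⟨B, hB, hc⟩ := Finset.exists_subset_card_eq (le_of_not_ge h)
    refine ⟨B, A \ B, Finset.union_sdiff_of_subset hB, hc.le, ?_⟩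
    rw [Finset.card_sdiff_of_subset hB]
    omega

theorem GateRealizable.condGate_of_card_le_one {q : ℕ} {A : Finset (Fin q)} {t : Fin q}
    (ht : t ∉ A) (hA : A.card ≤ 1) (b : QubitBasis q) {G : Matrix (Fin 2) (Fin 2) ℂ}
    (hG : G ∈ Matrix.unitaryGroup (Fin 2) ℂ) : GateRealizable (condGate A b t G) 1 := by
  rcases Nat.le_one_iff_eq_zero_or_eq_one.1 hA with h | h
  · rw [Finset.card_eq_zero.1 h]
    simpa [condGate] using GateRealizable.muxGate_one t hG
  · obtain ⟨c, rfl⟩ := Finset.card_eq_one.1 h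
    have hct : c ≠ t := fun h => ht (by simp [h])
    simpa [condGate] using GateRealizable.muxGate_two hct (b c) hG

/-- Halving the set of controls and taking a commutator costs four gates with half as many controls,
hence `4 ^ h` gates for `2 ^ h` controls. Rotations and phases are treated together because each
recursion calls the other. -/
theorem GateRealizable.condGate_rotGate_and_phaseGate {q : ℕ} (b : QubitBasis q) {t : Fin q}
    (h : ℕ) : ∀ {A : Finset (Fin q)}, t ∉ A → A.card ≤ 2 ^ h → ∀ θ,
      GateRealizable (condGate A b t (rotGate θ)) (4 ^ h) ∧
      GateRealizable (condGate A b t (phaseGate θ)) (4 ^ h) := by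
  induction h with
  | zero =>
    intro A ht hA θ
    exact ⟨condGate_of_card_le_one ht hA b (rotGate_mem_unitaryGroup θ),
      condGate_of_card_le_one ht hA b (phaseGate_mem_unitaryGroup θ)⟩
  | succ h ih =>
    intro A ht hA θ
    obtain ⟨B, C, rfl, hB, hC⟩ := exists_union_card_le A (N := 2 ^ h) (by rwa [pow_succ'] at hA)
    have htB : t ∉ B := fun h => ht (Finset.mem_union_left _ h)
    have htC : t ∉ C := fun h => ht (Finset.mem_union_right _ h)
    have h4 : 4 ^ (h + 1) = 4 ^ h + 4 ^ h + 4 ^ h + 4 ^ h := by ring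
    rw [h4]
    constructor
    · rw [rotGate_eq_commutator, condGate_union_commutator htB htC]
      · exact (((ih htB hB _).1.mul (ih htC hC _).2).mul (ih htB hB _).1).mul (ih htC hC _).2
      · rw [rotGate_mul, add_neg_cancel, rotGate_zero]
      · rw [phaseGate_mul, add_neg_cancel, phaseGate_zero]
    · rw [phaseGate_eq_commutator, condGate_union_commutator htB htC]
      · exact (((ih htB hB _).2.mul (ih htC hC _).1).mul (ih htB hB _).2).mul (ih htC hC _).1
      · rw [phaseGate_mul, add_neg_cancel, phaseGate_zero]
      · rw [rotGate_mul, add_neg_cancel, rotGate_zero]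

theorem indepOf_register {l q : ℕ} {idx : Fin l ↪ Fin q} {f : Fin q} (hf : f ∉ Set.range idx)
    {β : Type*} (F : QubitBasis l → β) :
    IndepOf (singleWire f) fun s : QubitBasis q => F (s ∘ idx) := by
  intro s u h
  have : s ∘ idx = u ∘ idx := by
    funext i
    refine h _ ?_
    rw [range_singleWire]
    rintro rfl
    exact hf ⟨i, rfl⟩
  simp only [this]

/-- A rotation controlled by the state of a register of `l` qubits. -/
theorem GateRealizable.muxGate_rotGate {l q : ℕ} (idx : Fin l ↪ Fin q) {f : Fin q}
    (hf : f ∉ Set.range idx) (β : QubitBasis l) (θ : ℝ) :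
    GateRealizable (muxGate f fun s => if s ∘ idx = β then rotGate θ else 1)
      (4 ^ Nat.clog 2 l) := by
  have h := (condGate_rotGate_and_phaseGate (Function.extend idx β 0) (t := f) (Nat.clog 2 l)
    (A := Finset.univ.map idx) (by simpa using hf)
    (by simpa using Nat.le_pow_clog one_lt_two l) θ).1
  convert h using 1
  rw [condGate]
  congr 1
  funext s
  refine if_congr ?_ rfl rfl
  simp [funext_iff, idx.injective.extend_apply]

/-- The power of two rounding `l` up is at most `2 * l`; its square is the cost of a gate with `l`
controls. -/
theorem four_pow_clog_le {l : ℕ} (hl : 1 ≤ l) : 4 ^ Nat.clog 2 l ≤ 4 * l ^ 2 := by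
  rcases hl.eq_or_lt with rfl | hl
  · simp
  · have h := Nat.pow_pred_clog_lt_self one_lt_two hl
    have h1 : 1 ≤ Nat.clog 2 l := Nat.clog_pos one_lt_two hl
    obtain ⟨c, hc⟩ := Nat.exists_eq_add_of_le' h1
    rw [hc] at h ⊢
    simp only [Nat.pred_eq_sub_one, Nat.add_sub_cancel] at h
    have : (4 : ℕ) ^ c = (2 ^ c) ^ 2 := by
      rw [← pow_mul, mul_comm, pow_mul]
      norm_num
    rw [pow_succ, this, mul_comm]
    exact Nat.mul_le_mul_left 4 (Nat.pow_le_pow_left h.le 2)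

/-! ### Preparation of a superposition of register states -/

/-- The label `s` with the register `idx` replaced by `β` and the flag `f` replaced by `c`. -/
noncomputable def setRegister {l q : ℕ} (idx : Fin l ↪ Fin q) (f : Fin q) (s : QubitBasis q)
    (β : QubitBasis l) (c : Fin 2) : QubitBasis q :=
  Function.update (Function.extend idx β s) f c

section Register

variable {l q : ℕ} {idx : Fin l ↪ Fin q} {f : Fin q}

theorem setRegister_flag (s : QubitBasis q) (β : QubitBasis l) (c : Fin 2) :
    setRegister idx f s β c f = c := Function.update_self _ _ _

theorem setRegister_comp (hf : f ∉ Set.range idx) (s : QubitBasis q) (β : QubitBasis l)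
    (c : Fin 2) : setRegister idx f s β c ∘ idx = β := by
  funext i
  have : idx i ≠ f := fun h => hf ⟨i, h⟩
  rw [Function.comp_apply, setRegister, Function.update_of_ne this, idx.injective.extend_apply]

theorem setRegister_of_ne (s : QubitBasis q) (β : QubitBasis l) (c : Fin 2) {i : Fin q}
    (hi : i ∉ Set.range idx) (hif : i ≠ f) : setRegister idx f s β c i = s i := by
  rw [setRegister, Function.update_of_ne hif, Function.extend_apply' _ _ _ (by simpa using hi)]

theorem setRegister_self (s : QubitBasis q) : setRegister idx f s (s ∘ idx) (s f) = s := by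
  rw [setRegister, (AgreeOff.refl idx s).extend_eq, Function.update_eq_self]

theorem update_setRegister_flag (s : QubitBasis q) (β : QubitBasis l) (c c' : Fin 2) :
    Function.update (setRegister idx f s β c) f c' = setRegister idx f s β c' :=
  Function.update_idem _ _ _

theorem update_setRegister_idx (hf : f ∉ Set.range idx) (s : QubitBasis q) (β : QubitBasis l)
    (c : Fin 2) (i : Fin l) (b : Fin 2) :
    Function.update (setRegister idx f s β c) (idx i) b =
      setRegister idx f s (Function.update β i b) c := by
  have hif : idx i ≠ f := fun h => hf ⟨i, h⟩
  rw [setRegister, Function.update_comm hif.symm, setRegister]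
  congr 1
  funext j
  by_cases hj : j ∈ Set.range idx
  · obtain ⟨j, rfl⟩ := hj
    rw [idx.injective.extend_apply, Function.update_apply, Function.update_apply,
      idx.injective.extend_apply]
    simp
  · rw [Function.update_of_ne (fun h => hj ⟨i, h.symm⟩),
      Function.extend_apply' _ _ _ (by simpa using hj),
      Function.extend_apply' _ _ _ (by simpa using hj)]

/-- The Pauli `X` gate. -/
noncomputable def flipGate : Matrix (Fin 2) (Fin 2) ℂ := !![0, 1; 1, 0]

theorem flipGate_mem_unitaryGroup : flipGate ∈ Matrix.unitaryGroup (Fin 2) ℂ := by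
  rw [Matrix.mem_unitaryGroup_iff]
  ext i j
  fin_cases i <;> fin_cases j <;> simp [flipGate, Matrix.mul_apply, Matrix.star_apply]

theorem indepOf_wire {c t : Fin q} (hct : c ≠ t) {β : Type*} (F : Fin 2 → β) :
    IndepOf (singleWire t) fun s : QubitBasis q => F (s c) := by
  intro s u h
  simp only [h c (by rw [range_singleWire]; exact hct)]

/-- If the flag is set, the bits in `L` of the register can be moved from `β` to `γ`. -/
theorem exists_controlled_move (hf : f ∉ Set.range idx) (β γ : QubitBasis l) (L : List (Fin l))
    (hL : L.Nodup) : ∃ M : QubitOp q, GateRealizable M L.length ∧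
      (∀ s β', M *ᵥ Pi.single (setRegister idx f s β' 0) 1 =
        Pi.single (setRegister idx f s β' 0) 1) ∧
      ∀ s, M *ᵥ Pi.single (setRegister idx f s β 1) 1 =
        Pi.single (setRegister idx f s (fun i => if i ∈ L then γ i else β i) 1) 1 := by
  induction L with
  | nil => exact ⟨1, GateRealizable.one, fun s β' => Matrix.one_mulVec _, fun s => by
      rw [Matrix.one_mulVec]; simp⟩
  | cons i L ih =>
    obtain ⟨M, hM, h0, h1⟩ := ih hL.of_cons
    have hiL : i ∉ L := (List.nodup_cons.1 hL).1
    have hfi : f ≠ idx i := fun h => hf ⟨i, h.symm⟩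
    let G : Matrix (Fin 2) (Fin 2) ℂ := if β i = γ i then 1 else flipGate
    have hG : G ∈ Matrix.unitaryGroup (Fin 2) ℂ := by
      unfold G
      split_ifs
      exacts [one_mem _, flipGate_mem_unitaryGroup]
    have hGi : ∀ b, G b (β i) = if b = γ i then 1 else 0 := by
      intro b
      unfold G
      generalize β i = x
      generalize γ i = y
      fin_cases b <;> fin_cases x <;> fin_cases y <;> simp [flipGate]
    have hind := indepOf_wire hfi fun c => if c = 1 then G else 1
    refine ⟨_ * M, by
      rw [List.length_cons, add_comm]
      exact (GateRealizable.muxGate_two hfi 1 hG).mul hM, fun s β' => ?_, fun s => ?_⟩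
    · rw [← Matrix.mulVec_mulVec, h0, muxGate_mulVec_single _ hind]
      simp only [setRegister_flag]
      simp [Matrix.one_apply]
    · rw [← Matrix.mulVec_mulVec, h1, muxGate_mulVec_single _ hind]
      have hidx : setRegister idx f s (fun i => if i ∈ L then γ i else β i) 1 (idx i) = β i := by
        have := congrFun (setRegister_comp hf s (fun i => if i ∈ L then γ i else β i) 1) i
        rw [Function.comp_apply] at this
        rw [this, if_neg hiL]
      simp only [setRegister_flag, if_true, hidx, hGi]
      simp only [ite_smul, one_smul, zero_smul, Finset.sum_ite_eq', Finset.mem_univ, if_true]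
      rw [update_setRegister_idx hf]
      congr 2
      funext j
      by_cases hj : j = i
      · subst hj; simp
      · rw [Function.update_of_ne hj]; simp [hj]

theorem exists_angle {r r' a : ℝ} (hr : 0 ≤ r) (h : r' ^ 2 + a ^ 2 = r ^ 2) :
    ∃ θ, r * Real.cos θ = r' ∧ r * Real.sin θ = a := by
  have hn : ‖(⟨r', a⟩ : ℂ)‖ = r := by
    rw [Complex.norm_def, Complex.normSq_mk, ← sq, ← sq, h, Real.sqrt_sq hr]
  refine ⟨Complex.arg ⟨r', a⟩, ?_, ?_⟩
  · have := Complex.norm_mul_cos_arg ⟨r', a⟩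
    rwa [hn] at this
  · have := Complex.norm_mul_sin_arg ⟨r', a⟩
    rwa [hn] at this

/-- The amplitudes `a 0, …, a (K - 1)` can be put on the register states `g 0, …, g (K - 1)`, the
remaining amplitude staying on the state `g K` with the flag set. -/
theorem exists_partial_preparation (hf : f ∉ Set.range idx) (g : ℕ → QubitBasis l) (a : ℕ → ℝ)
    -- The parking state `g K` need not differ from the earlier ones, since the flag tells them
    -- apart. This matters when the `K` states fill the whole register.
    (K : ℕ) (hg : Set.InjOn g (Set.Iio K))
    (ha : ∀ k ≤ K, ∑ j ∈ Finset.range k, a j ^ 2 ≤ 1) :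
    ∃ M : QubitOp q, GateRealizable M (1 + K * (4 ^ Nat.clog 2 l + l)) ∧
      ∀ s, M *ᵥ Pi.single (setRegister idx f s (g 0) 0) 1 =
        ∑ j ∈ Finset.range K, (a j : ℂ) • Pi.single (setRegister idx f s (g j) 0) 1 +
          (Real.sqrt (1 - ∑ j ∈ Finset.range K, a j ^ 2) : ℂ) •
            Pi.single (setRegister idx f s (g K) 1) 1 := by
  induction K with
  | zero =>
    -- Before any amplitude is deposited, the whole of it is parked on `g 0` with the flag set, by
    -- one flip of the flag.
    refine ⟨_, (GateRealizable.muxGate_one f flipGate_mem_unitaryGroup).mono (by omega),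
      fun s => ?_⟩
    rw [muxGate_mulVec_single _ (indepOf_const _ _)]
    simp [setRegister_flag, update_setRegister_flag, flipGate]
  | succ K ih =>
    obtain ⟨M, hM, hMs⟩ := ih (hg.mono (Set.Iio_subset_Iio K.le_succ))
      fun k hk => ha k (hk.trans K.le_succ)
    obtain ⟨N, hN, hN0, hN1⟩ := exists_controlled_move hf (g K) (g (K + 1)) (List.finRange l)
      (List.nodup_finRange l)
    -- The rotation splits the parked amplitude: `a K` drops to flag `0` and stays on `g K`, and the
    -- rest keeps flag `1`. The move controlled by the flag then carries the rest to `g (K + 1)`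
    -- without disturbing what was deposited.
    obtain ⟨θ, hc, hs⟩ := exists_angle
      (r' := Real.sqrt (1 - ∑ j ∈ Finset.range (K + 1), a j ^ 2)) (a := a K)
      (Real.sqrt_nonneg (1 - ∑ j ∈ Finset.range K, a j ^ 2)) (by
        rw [Real.sq_sqrt (by linarith [ha (K + 1) le_rfl]),
          Real.sq_sqrt (by linarith [ha K K.le_succ]), Finset.sum_range_succ]
        ring)
    have hind := indepOf_register hf fun β => if β = g K then rotGate θ else 1
    refine ⟨N * (muxGate f (fun s => if s ∘ idx = g K then rotGate θ else 1) * M), ?_,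
      fun s => ?_⟩
    · refine (hN.mul ((GateRealizable.muxGate_rotGate idx hf (g K) θ).mul hM)).mono ?_
      rw [List.length_finRange, add_mul]
      omega
    · rw [← Matrix.mulVec_mulVec, ← Matrix.mulVec_mulVec, hMs, Matrix.mulVec_add,
        Matrix.mulVec_add, Matrix.mulVec_sum, Matrix.mulVec_sum, Finset.sum_range_succ]
      simp_rw [Matrix.mulVec_smul]
      rw [add_assoc]
      congr 1
      · refine Finset.sum_congr rfl fun j hj => ?_
        have hj' := Finset.mem_range.1 hj
        have hne : g j ≠ g K := fun h =>
          hj'.ne (hg (Set.mem_Iio.2 (by omega)) (Set.mem_Iio.2 (by omega)) h)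
        have : muxGate f (fun s => if s ∘ idx = g K then rotGate θ else 1) *ᵥ
            Pi.single (setRegister idx f s (g j) 0) (1 : ℂ) =
              Pi.single (setRegister idx f s (g j) 0) 1 := by
          rw [muxGate_mulVec_single _ hind]
          simp [setRegister_comp hf, hne, update_setRegister_flag, setRegister_flag,
            Matrix.one_apply]
        rw [this, hN0]
      · rw [muxGate_mulVec_single _ hind]
        simp only [setRegister_comp hf, if_true, update_setRegister_flag, setRegister_flag,
          Fin.sum_univ_two, rotGate]
        rw [Matrix.mulVec_add, Matrix.mulVec_smul, Matrix.mulVec_smul, hN0, hN1, smul_add,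
          smul_smul, smul_smul]
        simp only [List.mem_finRange, if_true]
        rw [← hs, ← hc]
        simp

/-- Amplitudes `a 0, …, a K` of norm one can be put on the register states `g 0, …, g K`. -/
theorem exists_preparation (hf : f ∉ Set.range idx) (g : ℕ → QubitBasis l) (a : ℕ → ℝ)
    (K : ℕ) (hg : Set.InjOn g (Set.Iio K)) (ha : ∑ j ∈ Finset.range K, a j ^ 2 = 1) :
    ∃ M : QubitOp q, GateRealizable M (1 + K * (4 ^ Nat.clog 2 l + l)) ∧
      ∀ s, M *ᵥ Pi.single (setRegister idx f s (g 0) 0) 1 =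
        ∑ j ∈ Finset.range K, (a j : ℂ) • Pi.single (setRegister idx f s (g j) 0) 1 := by
  obtain ⟨M, hM, h⟩ := exists_partial_preparation hf g a K hg fun k hk => by
    rw [← ha]
    exact Finset.sum_le_sum_of_subset_of_nonneg (Finset.range_mono hk) fun _ _ _ => sq_nonneg _
  refine ⟨M, hM, fun s => ?_⟩
  rw [h, ha]
  simp

end Register

/-! ### Circuits with controlled black boxes -/

/-- The operator `M U` is performed by a circuit with the given number of calls, size and depth. -/
def CircuitRealizable {q m : ℕ} {ι : Type} (M : (ι → QubitOp m) → QubitOp q)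
    (calls size depth : ℕ) : Prop :=
  ∃ c : QCircuit q m ι, c.calls ≤ calls ∧ c.size ≤ size ∧ c.depth ≤ depth ∧
    ∀ U, QCircuit.toOp U c = M U

section Circuits

variable {q m : ℕ} {ι : Type}

theorem QCircuit.toOp_append (U : ι → QubitOp m) (c c' : QCircuit q m ι) :
    QCircuit.toOp U (c ++ c') = QCircuit.toOp U c' * QCircuit.toOp U c := by
  induction c with
  | nil => simp [QCircuit.toOp]
  | cons s c ih =>
    rw [List.cons_append, QCircuit.toOp, ih, QCircuit.toOp, mul_assoc]

theorem CircuitRealizable.mul {M M' : (ι → QubitOp m) → QubitOp q} {a b c a' b' c' : ℕ}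
    (h : CircuitRealizable M a b c) (h' : CircuitRealizable M' a' b' c') :
    CircuitRealizable (fun U => M U * M' U) (a + a') (b + b') (c + c') := by
  obtain ⟨C, h1, h2, h3, h4⟩ := h
  obtain ⟨C', h1', h2', h3', h4'⟩ := h'
  refine ⟨C' ++ C, ?_, ?_, ?_, fun U => by rw [QCircuit.toOp_append, h4, h4']⟩
  · simp only [QCircuit.calls, List.map_append, List.sum_append] at *; omega
  · simp only [QCircuit.size, List.map_append, List.sum_append] at *; omega
  · simp only [QCircuit.depth, List.map_append, List.sum_append] at *; omega

theorem CircuitRealizable.mono {M : (ι → QubitOp m) → QubitOp q} {a b c a' b' c' : ℕ}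
    (h : CircuitRealizable M a b c) (ha : a ≤ a') (hb : b ≤ b') (hc : c ≤ c') :
    CircuitRealizable M a' b' c' := by
  obtain ⟨C, h1, h2, h3, h4⟩ := h
  exact ⟨C, h1.trans ha, h2.trans hb, h3.trans hc, h4⟩

theorem CircuitRealizable.one :
    CircuitRealizable (fun _ : ι → QubitOp m => (1 : QubitOp q)) 0 0 0 :=
  ⟨[], le_rfl, le_rfl, le_rfl, fun _ => rfl⟩

theorem CircuitRealizable.layer (L : List (PrimitiveGate q))
    (hL : L.Pairwise fun g g' => Disjoint (Set.range g.wires) (Set.range g'.wires)) :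
    CircuitRealizable (fun _ : ι → QubitOp m => (L.map PrimitiveGate.toOp).prod) 0 L.length 1 :=
  ⟨[.layer L hL], le_rfl, le_rfl, le_rfl, fun _ => one_mul _⟩

theorem CircuitRealizable.of_gates {M : QubitOp q} {N : ℕ} (h : GateRealizable M N) :
    CircuitRealizable (fun _ : ι → QubitOp m => M) 0 N N := by
  obtain ⟨L, hL, rfl⟩ := h
  refine mono ?_ le_rfl hL hL
  clear hL
  induction L with
  | nil => exact one
  | cons g L ih =>
    have h := (layer (ι := ι) (m := m) [g] (List.pairwise_singleton _ _)).mul ih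
    rw [List.length_cons, add_comm]
    simpa using h

theorem CircuitRealizable.call (o : ι) {c : Fin q} {w : Fin m ↪ Fin q} (hc : c ∉ Set.range w) :
    CircuitRealizable (fun U => mux w (fun s => if s c = 1 then U o else 1)) 1 0 0 := by
  refine ⟨[.call o (consWires c w hc)], le_rfl, le_rfl, le_rfl, fun U => ?_⟩
  refine (one_mul _).trans ?_
  exact applyOnWires_controlledOn c w hc 1 (U o)

/-! ### Selection of the black boxes -/

theorem AgreeOff.comp_eq {l : ℕ} {w : Fin m → Fin q} {idx : Fin l → Fin q}
    (h : Disjoint (Set.range idx) (Set.range w)) {s u : QubitBasis q} (hs : AgreeOff w s u) :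
    s ∘ idx = u ∘ idx :=
  funext fun i => hs _ (Set.disjoint_left.1 h ⟨i, rfl⟩)

theorem update_comp_of_notMem {l : ℕ} {idx : Fin l → Fin q} {f : Fin q}
    (hf : f ∉ Set.range idx) (s : QubitBasis q) (b : Fin 2) :
    Function.update s f b ∘ idx = s ∘ idx :=
  funext fun i => Function.update_of_ne (fun h => hf ⟨i, h⟩) _ _

theorem agreeOff_update_iff {w : Fin m → Fin q} {f : Fin q} (s u : QubitBasis q) :
    AgreeOff w s (Function.update u f (s f)) ↔ AgreeOff w (Function.update s f (u f)) u := by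
  refine forall₂_congr fun i _ => ?_
  by_cases hi : i = f
  · subst hi; simp
  · simp [Function.update_of_ne hi]

/-- Conjugation of a controlled operator by a flag computation. -/
theorem mux_mul_flag {l : ℕ} {idx : Fin l ↪ Fin q} {f : Fin q} {w : Fin m ↪ Fin q}
    (hf : f ∉ Set.range idx) (hfw : f ∉ Set.range w)
    (hd : Disjoint (Set.range idx) (Set.range w)) (β : QubitBasis l) (V : QubitOp m) :
    mux w (fun s => if s f = 1 then V else 1) *
        muxGate f (fun s => if s ∘ idx = β then rotGate (Real.pi / 2) else 1) =
      muxGate f (fun s => if s ∘ idx = β then rotGate (Real.pi / 2) else 1) *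
        mux w (fun s => if (s ∘ idx = β ↔ s f = 0) then V else 1) := by
  ext s u
  rw [mul_muxGate_apply _ (indepOf_register hf fun β' => if β' = β then _ else _),
    muxGate_mul_apply, Finset.sum_eq_single (s f), Finset.sum_eq_single (u f)]
  · by_cases h : AgreeOff w s (Function.update u f (s f))
    · have h' := (agreeOff_update_iff s u).1 h
      have hsu : s ∘ idx = u ∘ idx := by
        rw [h.comp_eq hd, update_comp_of_notMem hf]
      rw [mux_apply_of_agree h, mux_apply_of_agree h', update_comp_of_notMem hfw,
        update_comp_of_notMem hfw, update_comp_of_notMem hf, Function.update_self, hsu, mul_comm]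
      -- `rotGate (π / 2)` has zero diagonal: on the register state `β` it exchanges the flag values
      -- up to sign. It replaces the Pauli flip because the commutator construction yields
      -- rotations.
      by_cases hβ : u ∘ idx = β
      · simp only [hβ, if_true, true_iff]
        generalize s f = x
        generalize u f = y
        fin_cases x <;> fin_cases y <;> simp [rotGate]
      · simp only [hβ, if_false, false_iff]
        generalize s f = x
        generalize u f = y
        fin_cases x <;> fin_cases y <;> simp
    · rw [mux_apply_of_not_agree h, mux_apply_of_not_agree fun h' =>
        h ((agreeOff_update_iff s u).2 h'), zero_mul, mul_zero]
  · intro b _ hb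
    rw [mux_apply_of_not_agree, mul_zero]
    intro h
    have := h f hfw
    rw [Function.update_self] at this
    exact hb this
  · simp
  · intro b _ hb
    rw [mux_apply_of_not_agree, zero_mul]
    intro h
    have := h f hfw
    rw [Function.update_self] at this
    exact hb this.symm
  · simp

theorem indepOf_register_flag {l : ℕ} {idx : Fin l → Fin q} {f : Fin q} {w : Fin m → Fin q}
    (hfw : f ∉ Set.range w) (hd : Disjoint (Set.range idx) (Set.range w)) {γ : Type*}
    (F : QubitBasis l → Fin 2 → γ) :
    IndepOf w fun s : QubitBasis q => F (s ∘ idx) (s f) := by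
  intro s u h
  simp only [h.comp_eq hd, h f hfw]

/-- The rotation controlled by the register is undone after the call, so its signs cancel. With the
flag unset, the black box acts exactly on the register state `β`. -/
theorem CircuitRealizable.flagged_call {l : ℕ} {idx : Fin l ↪ Fin q} {f : Fin q}
    {w : Fin m ↪ Fin q} (hf : f ∉ Set.range idx) (hfw : f ∉ Set.range w)
    (hd : Disjoint (Set.range idx) (Set.range w)) (β : QubitBasis l) (o : ι) :
    CircuitRealizable
      (fun U => mux w (fun s => if (s ∘ idx = β ↔ s f = 0) then U o else 1))
      1 (2 * 4 ^ Nat.clog 2 l) (2 * 4 ^ Nat.clog 2 l) := by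
  have hg := GateRealizable.muxGate_rotGate idx hf β (Real.pi / 2)
  have h := ((of_gates (ι := ι) (m := m) hg.conjTranspose).mul (call o hfw)).mul (of_gates hg)
  have hu : (muxGate f (fun s : QubitBasis q => if s ∘ idx = β then rotGate (Real.pi / 2) else 1))
      ∈ Matrix.unitaryGroup (QubitBasis q) ℂ := by
    refine mux_mem_unitaryGroup _ (indepOf_register hf fun β' => oneQubit (if β' = β then _ else _))
      fun s => oneQubit_mem_unitaryGroup ?_
    dsimp only
    split_ifs
    exacts [rotGate_mem_unitaryGroup _, one_mem _]
  rw [Matrix.mem_unitaryGroup_iff', Matrix.star_eq_conjTranspose] at hu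
  simp_rw [mul_assoc, mux_mul_flag hf hfw hd, ← mul_assoc, hu, one_mul] at h
  exact h.mono (by omega) (by omega) (by omega)

/-- On the register state `g k` (with the flag unset) the black box `o k` is applied. -/
theorem CircuitRealizable.select {l : ℕ} {idx : Fin l ↪ Fin q} {f : Fin q}
    {w : Fin m ↪ Fin q} (hf : f ∉ Set.range idx) (hfw : f ∉ Set.range w)
    (hd : Disjoint (Set.range idx) (Set.range w)) (g : ℕ → QubitBasis l) (o : ℕ → ι) (K : ℕ)
    (hg : Set.InjOn g (Set.Iio K)) :
    ∃ F : (ι → QubitOp m) → QubitBasis l → Fin 2 → QubitOp m,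
      CircuitRealizable (fun U => mux w fun s => F U (s ∘ idx) (s f)) K
        (K * (2 * 4 ^ Nat.clog 2 l)) (K * (2 * 4 ^ Nat.clog 2 l)) ∧
      (∀ U, ∀ k < K, F U (g k) 0 = U (o k)) ∧ ∀ U β, (∀ k < K, β ≠ g k) → F U β 0 = 1 := by
  induction K with
  | zero =>
    refine ⟨fun _ _ _ => 1, ?_, by simp, by simp⟩
    simp_rw [mux_one]
    exact one.mono (by simp) (by simp) (by simp)
  | succ K ih =>
    obtain ⟨F, hF, h1, h2⟩ := ih (hg.mono (Set.Iio_subset_Iio K.le_succ))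
    -- With the flag set, unwanted black boxes accumulate. Only the values at flag `0` are recorded,
    -- because the preparation ends there.
    refine ⟨fun U β c => (if (β = g K ↔ c = 0) then U (o K) else 1) * F U β c, ?_, ?_, ?_⟩
    · have h := (flagged_call hf hfw hd (g K) (o K)).mul hF
      simp_rw [mux_mul_mux w _ (indepOf_register_flag hfw hd _)] at h
      exact h.mono (by omega) (by rw [add_mul]; omega) (by rw [add_mul]; omega)
    · intro U k hk
      rcases Nat.lt_succ_iff_lt_or_eq.1 hk with hk' | rfl
      · have hne : g k ≠ g K := fun h =>
          hk'.ne (hg (Set.mem_Iio.2 hk) (Set.mem_Iio.2 (by omega)) h)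
        simp [hne, h1 U k hk']
      · have := h2 U (g k) fun j hj h =>
          hj.ne' (hg (Set.mem_Iio.2 hk) (Set.mem_Iio.2 (by omega)) h)
        simp [this]
    · intro U β hβ
      simp [hβ K (by omega), h2 U β fun k hk => hβ k (by omega)]

/-! ### A layer of two-qubit gates -/

/-- A product of gates on disjoint wires is a tensor product, so its entries are products of
entries. In the induction the later gates fix the wires of the first one, which leaves a single
intermediate label. -/
theorem layer_prod_apply {κ : Type*} {p : ℕ} (w : κ → Fin p ↪ Fin q) (G : QubitOp p)
    (L : List κ) (hL : L.Pairwise fun j k => Disjoint (Set.range (w j)) (Set.range (w k)))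
    (s t : QubitBasis q) :
    (L.map fun l => applyOnWires (w l) G).prod s t = open Classical in
      if ∀ i, (∀ l ∈ L, i ∉ Set.range (w l)) → s i = t i then
        (L.map fun l => G (s ∘ w l) (t ∘ w l)).prod else 0 := by
  classical
  induction L generalizing s with
  | nil => simp [Matrix.one_apply, funext_iff]
  | cons l L ih =>
    rw [List.pairwise_cons] at hL
    rw [List.map_cons, List.prod_cons, ← mux_const, mux_mul_apply,
      Finset.sum_eq_single (t ∘ w l), ih hL.2, List.map_cons, List.prod_cons]
    · have h1 : ∀ j ∈ L, Function.extend (w l) (t ∘ w l) s ∘ w j = s ∘ w j := by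
        intro j hj
        funext i
        rw [Function.comp_apply, Function.extend_apply']
        · rfl
        · rintro ⟨i', hi'⟩
          exact Set.disjoint_left.1 (hL.1 j hj) ⟨i', rfl⟩ ⟨i, hi'.symm⟩
      have h2 : (∀ i, (∀ j ∈ L, i ∉ Set.range (w j)) →
          Function.extend (w l) (t ∘ w l) s i = t i) ↔
          ∀ i, (∀ j ∈ l :: L, i ∉ Set.range (w j)) → s i = t i := by
        refine forall_congr' fun i => ?_
        by_cases hi : i ∈ Set.range (w l)
        · obtain ⟨i', rfl⟩ := hi
          rw [(w l).injective.extend_apply]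
          simp
        · rw [Function.extend_apply' _ _ _ (by simpa using hi)]
          simp only [List.forall_mem_cons]
          exact ⟨fun h h' => h h'.2, fun h h' => h ⟨hi, h'⟩⟩
      rw [if_congr h2 rfl rfl, mul_ite, mul_zero]
      congr 3
      exact List.map_congr_left fun j hj => by rw [h1 j hj]
    · intro r _ hr
      rw [ih hL.2, if_neg, mul_zero]
      intro h
      refine hr (funext fun i => ?_)
      have := h (w l i) fun j hj => Set.disjoint_left.1 (hL.1 j hj) ⟨i, rfl⟩
      rwa [(w l).injective.extend_apply] at this
    · simp

/-- A swap with Hadamard gates on the second qubit before and after. -/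
noncomputable def swapHadamard : QubitOp 2 :=
  fun s t => (1 / 2) * (if s 1 = 1 ∧ t 0 = 1 then -1 else 1) * if s 0 = 1 ∧ t 1 = 1 then -1 else 1

theorem swapHadamard_mem_unitaryGroup :
    swapHadamard ∈ Matrix.unitaryGroup (QubitBasis 2) ℂ := by
  rw [Matrix.mem_unitaryGroup_iff]
  ext s t
  have hst : s = t ↔ s 0 = t 0 ∧ s 1 = t 1 := by
    simp [funext_iff, Fin.forall_fin_two]
  rw [Matrix.mul_apply, ← (finTwoArrowEquiv (Fin 2)).symm.sum_comp, Fintype.sum_prod_type,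
    Matrix.one_apply, if_congr hst rfl rfl]
  simp only [swapHadamard, Matrix.star_apply, finTwoArrowEquiv_symm_apply, Fin.sum_univ_two,
    Matrix.cons_val_zero, Matrix.cons_val_one]
  generalize s 0 = a
  generalize s 1 = b
  generalize t 0 = c
  generalize t 1 = d
  fin_cases a <;> fin_cases b <;> fin_cases c <;> fin_cases d <;> norm_num

/-- With the first qubit in `|0⟩` before and after, the swap acts on the second as `|0⟩⟨0|`, and the
Hadamard gates turn this into `|+⟩⟨+|`. One such gate per system qubit yields `J` in depth one. -/
theorem swapHadamard_apply_of_zero {s t : QubitBasis 2} (hs : s 0 = 0) (ht : t 0 = 0) :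
    swapHadamard s t = 1 / 2 := by
  simp [swapHadamard, hs, ht]

end Circuits

/-! ### The block of the linear combination -/

theorem sum_ite_castAdd_eq_zero {a n : ℕ} {β : Type*} [AddCommMonoid β]
    (F : QubitBasis (a + n) → β) :
    (∑ r, if r ∘ Fin.castAdd n = 0 then F r else 0) =
      ∑ b : QubitBasis n, F (Fin.append (fun _ : Fin a => (0 : Fin 2)) b) := by
  rw [← (Fin.appendEquiv a n).sum_comp, Fintype.sum_prod_type, Finset.sum_eq_single 0]
  · refine Finset.sum_congr rfl fun b _ => if_pos ?_
    funext i
    simp [Fin.appendEquiv]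
  · intro r _ hr
    refine Finset.sum_eq_zero fun b _ => if_neg fun h => hr ?_
    rw [← h]
    funext i
    simp [Fin.appendEquiv]
  · simp

/-- Two distinct wires. -/
def pairWires {q : ℕ} {c t : Fin q} (h : c ≠ t) : Fin 2 ↪ Fin q :=
  consWires c (singleWire t) (by rw [range_singleWire]; exact h)

theorem range_pairWires {q : ℕ} {c t : Fin q} (h : c ≠ t) :
    Set.range (pairWires h) = {c, t} := by
  rw [pairWires, range_consWires, range_singleWire]

section Block

variable {q n a : ℕ} {sw sys : Fin n ↪ Fin q} {wU wV : Fin (a + n) ↪ Fin q}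

/-- The layer which projects the system on the uniform superposition. -/
noncomputable def projectionGates (h : ∀ j, sw j ≠ sys j) : List (PrimitiveGate q) :=
  (List.finRange n).map fun j =>
    ⟨2, Or.inr rfl, pairWires (h j), swapHadamard, swapHadamard_mem_unitaryGroup⟩

theorem disjoint_pairWires (hd : Disjoint (Set.range sw) (Set.range sys)) (h : ∀ j, sw j ≠ sys j)
    {j k : Fin n} (hjk : j ≠ k) :
    Disjoint (Set.range (pairWires (h j))) (Set.range (pairWires (h k))) := by
  rw [range_pairWires, range_pairWires, Set.disjoint_left]
  have h1 : ∀ j k, sw j ≠ sys k := fun j k e => Set.disjoint_left.1 hd ⟨j, rfl⟩ ⟨k, e.symm⟩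
  rintro i (rfl | rfl) (e | e)
  · exact hjk (sw.injective e)
  · exact h1 _ _ e
  · exact h1 _ _ e.symm
  · exact hjk (sys.injective e)

theorem projectionGates_pairwise (hd : Disjoint (Set.range sw) (Set.range sys))
    (h : ∀ j, sw j ≠ sys j) :
    (projectionGates h).Pairwise fun g g' => Disjoint (Set.range g.wires) (Set.range g'.wires) := by
  rw [projectionGates, List.pairwise_map]
  exact (List.nodup_finRange n).imp fun hjk => disjoint_pairWires hd h hjk

theorem projectionGates_apply (hd : Disjoint (Set.range sw) (Set.range sys))
    (h : ∀ j, sw j ≠ sys j) {s t : QubitBasis q} (hs : ∀ j, s (sw j) = 0) (ht : ∀ j, t (sw j) = 0) :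
    ((projectionGates h).map PrimitiveGate.toOp).prod s t = open Classical in
      if ∀ i, i ∉ Set.range sys → s i = t i then (1 / 2) ^ n else 0 := by
  rw [projectionGates, List.map_map]
  refine (layer_prod_apply (fun j => pairWires (h j)) swapHadamard _
    ((List.nodup_finRange n).imp fun hjk => disjoint_pairWires hd h hjk) s t).trans ?_
  have h1 : (List.finRange n).map (fun l => swapHadamard (s ∘ pairWires (h l))
      (t ∘ pairWires (h l))) = (List.finRange n).map fun _ => (1 / 2 : ℂ) :=
    List.map_congr_left fun j _ => swapHadamard_apply_of_zero (hs j) (ht j)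
  rw [h1, List.map_const', List.length_finRange, List.prod_replicate]
  have hiff : (∀ i, (∀ l ∈ List.finRange n, i ∉ Set.range (pairWires (h l))) → s i = t i) ↔
      ∀ i, i ∉ Set.range sys → s i = t i := by
    refine ⟨fun H i hi => ?_, fun H i hi => H i ?_⟩
    · by_cases hi' : i ∈ Set.range sw
      · obtain ⟨j, rfl⟩ := hi'
        rw [hs, ht]
      · refine H i fun l _ => ?_
        rw [range_pairWires]
        rintro (rfl | rfl)
        exacts [hi' ⟨l, rfl⟩, hi ⟨l, rfl⟩]
    · rintro ⟨l, rfl⟩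
      refine hi l (List.mem_finRange l) ?_
      rw [range_pairWires]
      exact Or.inr rfl
  by_cases H : ∀ i, i ∉ Set.range sys → s i = t i
  · rw [if_pos (hiff.2 H), if_pos H]
  · rw [if_neg (fun h' => H (hiff.1 h')), if_neg H]

theorem comp_eq_append {w : Fin (a + n) ↪ Fin q} (hw : ∀ j, w (Fin.natAdd a j) = sys j)
    {s : QubitBasis q} (hs : ∀ i, s (w (Fin.castAdd n i)) = 0) :
    s ∘ w = Fin.append (fun _ : Fin a => (0 : Fin 2)) (s ∘ sys) := by
  funext i
  refine Fin.addCases (fun i => ?_) (fun j => ?_) i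
  · simp [hs]
  · simp [hw]

/-- The ancillas of `wU` are touched only by the left factor and those of `wV` only by the right
one. Zero labels at both ends therefore force them to be zero next to the middle layer, and the
blocks multiply. -/
theorem select_project_select_apply (hd : Disjoint (Set.range sw) (Set.range sys))
    (h : ∀ j, sw j ≠ sys j)
    (hUs : ∀ j, wU (Fin.natAdd a j) = sys j) (hVs : ∀ j, wV (Fin.natAdd a j) = sys j)
    (hUV : ∀ i, wU (Fin.castAdd n i) ∉ Set.range wV)
    (hVU : ∀ i, wV (Fin.castAdd n i) ∉ Set.range wU)
    (hUw : Disjoint (Set.range sw) (Set.range wU)) (hVw : Disjoint (Set.range sw) (Set.range wV))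
    {FU FV : QubitBasis q → QubitOp (a + n)} (hFV : IndepOf wV FV)
    {s u : QubitBasis q} (hs : ∀ j, s (sw j) = 0) (hu : ∀ j, u (sw j) = 0)
    (hsU : ∀ i, s (wU (Fin.castAdd n i)) = 0) (huU : ∀ i, u (wU (Fin.castAdd n i)) = 0)
    (hsV : ∀ i, s (wV (Fin.castAdd n i)) = 0) (huV : ∀ i, u (wV (Fin.castAdd n i)) = 0) :
    (mux wU FU * (((projectionGates h).map PrimitiveGate.toOp).prod * mux wV FV)) s u =
      open Classical in if ∀ i, i ∉ Set.range sys → s i = u i then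
        ∑ b : QubitBasis n, ∑ b' : QubitBasis n,
          FU s (Fin.append (fun _ => 0) (s ∘ sys)) (Fin.append (fun _ => 0) b) * (1 / 2) ^ n *
            FV u (Fin.append (fun _ => 0) b') (Fin.append (fun _ => 0) (u ∘ sys)) else 0 := by
  classical
  have hsysU : ∀ j, sys j ∈ Set.range wU := fun j => ⟨_, hUs j⟩
  have hsysV : ∀ j, sys j ∈ Set.range wV := fun j => ⟨_, hVs j⟩
  have hcU : ∀ i, wU (Fin.castAdd n i) ∉ Set.range sys := by
    rintro i ⟨j, hj⟩
    exact hUV i (hj ▸ hsysV j)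
  have hcV : ∀ i, wV (Fin.castAdd n i) ∉ Set.range sys := by
    rintro i ⟨j, hj⟩
    exact hVU i (hj ▸ hsysU j)
  -- The middle layer preserves every wire outside `sys` and `sw`. Its entry vanishes unless the
  -- ancilla parts of `r` and `r'` are zero and `s`, `u` agree off the system.
  have hmid : ∀ r r' : QubitBasis (a + n),
      ((projectionGates h).map PrimitiveGate.toOp).prod (Function.extend wU r s)
        (Function.extend wV r' u) = if r ∘ Fin.castAdd n = 0 then if r' ∘ Fin.castAdd n = 0 then
          if ∀ i, i ∉ Set.range sys → s i = u i then (1 / 2) ^ n else 0 else 0 else 0 := by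
    intro r r'
    rw [projectionGates_apply hd h, ← ite_and, ← ite_and]
    · refine if_congr ⟨fun H => ⟨⟨?_, ?_⟩, fun i hi => ?_⟩, fun ⟨⟨hr, hr'⟩, H⟩ i hi => ?_⟩ rfl rfl
      · funext i
        have := H _ (hcU i)
        rw [wU.injective.extend_apply, Function.extend_apply' _ _ _ (by simpa using hUV i),
          huU] at this
        exact this
      · funext i
        have := H _ (hcV i)
        rw [wV.injective.extend_apply, Function.extend_apply' _ _ _ (by simpa using hVU i),
          hsV] at this
        exact this.symm
      · by_cases hiU : i ∈ Set.range wU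
        · obtain ⟨j, rfl⟩ := hiU
          revert hi
          refine Fin.addCases (fun j _ => ?_) (fun j hi => ?_) j
          · rw [hsU, huU]
          · exact absurd ⟨j, (hUs j).symm⟩ hi
        · by_cases hiV : i ∈ Set.range wV
          · obtain ⟨j, rfl⟩ := hiV
            revert hi
            refine Fin.addCases (fun j _ => ?_) (fun j hi => ?_) j
            · rw [hsV, huV]
            · exact absurd ⟨j, (hVs j).symm⟩ hi
          · have := H i hi
            rwa [Function.extend_apply' _ _ _ (by simpa using hiU),
              Function.extend_apply' _ _ _ (by simpa using hiV)] at this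
      · by_cases hiU : i ∈ Set.range wU
        · obtain ⟨j, rfl⟩ := hiU
          revert hi
          refine Fin.addCases (fun j _ => ?_) (fun j hi => ?_) j
          · rw [wU.injective.extend_apply, Function.extend_apply' _ _ _ (by simpa using hUV j), huU]
            exact congrFun hr j
          · exact absurd ⟨j, (hUs j).symm⟩ hi
        · by_cases hiV : i ∈ Set.range wV
          · obtain ⟨j, rfl⟩ := hiV
            revert hi
            refine Fin.addCases (fun j _ => ?_) (fun j hi => ?_) j
            · rw [wV.injective.extend_apply, Function.extend_apply' _ _ _ (by simpa using hVU j),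
                hsV]
              exact (congrFun hr' j).symm
            · exact absurd ⟨j, (hVs j).symm⟩ hi
          · rw [Function.extend_apply' _ _ _ (by simpa using hiU),
              Function.extend_apply' _ _ _ (by simpa using hiV), H i hi]
    · intro j
      rw [Function.extend_apply', hs]
      exact fun h' => Set.disjoint_left.1 hUw ⟨j, rfl⟩ h'
    · intro j
      rw [Function.extend_apply', hu]
      exact fun h' => Set.disjoint_left.1 hVw ⟨j, rfl⟩ h'
  simp_rw [mux_mul_apply, mul_mux_apply wV hFV, hmid, comp_eq_append hUs hsU,
    comp_eq_append hVs huV]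
  by_cases H : ∀ i, i ∉ Set.range sys → s i = u i
  · simp only [if_pos H]
    rw [← sum_ite_castAdd_eq_zero (fun r => ∑ b' : QubitBasis n,
      FU s (Fin.append (fun _ => 0) (s ∘ sys)) r * (1 / 2) ^ n *
        FV u (Fin.append (fun _ => 0) b') (Fin.append (fun _ => 0) (u ∘ sys)))]
    refine Finset.sum_congr rfl fun r _ => ?_
    by_cases hr : r ∘ Fin.castAdd n = 0
    · simp only [if_pos hr]
      rw [Finset.mul_sum, ← sum_ite_castAdd_eq_zero (fun r' =>
        FU s (Fin.append (fun _ => 0) (s ∘ sys)) r * (1 / 2) ^ n *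
        FV u r' (Fin.append (fun _ => 0) (u ∘ sys)))]
      refine Finset.sum_congr rfl fun r' _ => ?_
      split_ifs <;> ring
    · simp [hr]
  · simp only [if_neg H, ite_self, mul_zero, zero_mul, Finset.sum_const_zero]

end Block

theorem conjTranspose_mul_mul_apply {q : ℕ} {κ : Type*} (P N : QubitOp q) (S : Finset κ)
    (c : κ → ℝ) (x y : κ → QubitBasis q) {s u : QubitBasis q}
    (hs : P *ᵥ Pi.single s 1 = ∑ k ∈ S, (c k : ℂ) • Pi.single (x k) 1)
    (hu : P *ᵥ Pi.single u 1 = ∑ k ∈ S, (c k : ℂ) • Pi.single (y k) 1) :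
    (Pᴴ * N * P) s u = ∑ k ∈ S, ∑ k' ∈ S, (c k : ℂ) * c k' * N (x k) (y k') := by
  have h : (Pᴴ * N * P) s u =
      star (P *ᵥ Pi.single s 1) ⬝ᵥ (N *ᵥ (P *ᵥ Pi.single u 1)) := by
    rw [Matrix.star_mulVec, ← Matrix.dotProduct_mulVec, Matrix.mulVec_mulVec,
      Matrix.mulVec_mulVec]
    simp [mul_assoc]
  rw [h, hs, hu, Matrix.mulVec_sum, star_sum, sum_dotProduct]
  refine Finset.sum_congr rfl fun k _ => ?_
  rw [dotProduct_sum]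
  refine Finset.sum_congr rfl fun k' _ => ?_
  rw [Matrix.mulVec_smul, star_smul, ← Pi.single_star]
  simp [mul_assoc, mul_left_comm]

/-! ### Linear combinations of products -/

/-- The count adds two preparations of `1 + K * (4 ^ Nat.clog 2 l + l)` gates, two selections of `K
* (2 * 4 ^ Nat.clog 2 l)` gates and the middle layer, which has `n` gates but depth `1`. -/
theorem exists_circuit_on_wires {q n a l K : ℕ} {ι : Type} {sw sys : Fin n ↪ Fin q}
    {wU wV : Fin (a + n) ↪ Fin q} {idx : Fin l ↪ Fin q} {f : Fin q}
    (hd : Disjoint (Set.range sw) (Set.range sys))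
    (hUs : ∀ j, wU (Fin.natAdd a j) = sys j) (hVs : ∀ j, wV (Fin.natAdd a j) = sys j)
    (hUV : ∀ i, wU (Fin.castAdd n i) ∉ Set.range wV)
    (hVU : ∀ i, wV (Fin.castAdd n i) ∉ Set.range wU)
    (hUw : Disjoint (Set.range sw) (Set.range wU)) (hVw : Disjoint (Set.range sw) (Set.range wV))
    (hIU : Disjoint (Set.range idx) (Set.range wU)) (hIV : Disjoint (Set.range idx) (Set.range wV))
    (hIw : Disjoint (Set.range idx) (Set.range sw)) (hIs : Disjoint (Set.range idx) (Set.range sys))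
    (hfI : f ∉ Set.range idx) (hfU : f ∉ Set.range wU) (hfV : f ∉ Set.range wV)
    (g : ℕ → QubitBasis l) (hg : Set.InjOn g (Set.Iio K)) (hg0 : g 0 = 0)
    (p : ℕ → ℝ) (hp : ∀ k, 0 ≤ p k) (hp1 : ∑ k ∈ Finset.range K, p k = 1) (o o' : ℕ → ι) :
    ∃ c : QCircuit q (a + n) ι, c.calls ≤ 2 * K ∧
      c.size ≤ n + 2 + K * (6 * 4 ^ Nat.clog 2 l + 2 * l) ∧
      c.depth ≤ 3 + K * (6 * 4 ^ Nat.clog 2 l + 2 * l) ∧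
      ∀ (W : ι → QubitOp (a + n)) (s u : QubitBasis q), (∀ i, i ∉ Set.range sys → s i = 0) →
        (∀ i, i ∉ Set.range sys → u i = 0) →
        QCircuit.toOp W c s u = ∑ k ∈ Finset.range K, (p k : ℂ) *
          ∑ b : QubitBasis n, ∑ b' : QubitBasis n,
            W (o k) (Fin.append (fun _ => 0) (s ∘ sys)) (Fin.append (fun _ => 0) b) * (1 / 2) ^ n *
              W (o' k) (Fin.append (fun _ => 0) b') (Fin.append (fun _ => 0) (u ∘ sys)) := by
  have h : ∀ j, sw j ≠ sys j := fun j e => Set.disjoint_left.1 hd ⟨j, rfl⟩ ⟨j, e.symm⟩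
  obtain ⟨P, hP, hPs⟩ := exists_preparation hfI g (fun k => Real.sqrt (p k)) K hg (by
    simp_rw [Real.sq_sqrt (hp _)]
    exact hp1)
  obtain ⟨FU, hFU, hU, -⟩ := CircuitRealizable.select hfI hfU hIU g o K hg
  obtain ⟨FV, hFV, hV, -⟩ := CircuitRealizable.select hfI hfV hIV g o' K hg
  have hmid := CircuitRealizable.layer (m := a + n) (ι := ι) _ (projectionGates_pairwise hd h)
  obtain ⟨c, hc1, hc2, hc3, hc⟩ := ((CircuitRealizable.of_gates hP.conjTranspose).mul
    (hFU.mul (hmid.mul hFV))).mul (CircuitRealizable.of_gates hP)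
  have hlen : (projectionGates h).length = n := by simp [projectionGates]
  have hN : n + 2 + K * (6 * 4 ^ Nat.clog 2 l + 2 * l) = 1 + K * (4 ^ Nat.clog 2 l + l) +
      (K * (2 * 4 ^ Nat.clog 2 l) + (n + K * (2 * 4 ^ Nat.clog 2 l))) +
      (1 + K * (4 ^ Nat.clog 2 l + l)) := by ring
  have hN' : 3 + K * (6 * 4 ^ Nat.clog 2 l + 2 * l) = 1 + K * (4 ^ Nat.clog 2 l + l) +
      (K * (2 * 4 ^ Nat.clog 2 l) + (1 + K * (2 * 4 ^ Nat.clog 2 l))) +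
      (1 + K * (4 ^ Nat.clog 2 l + l)) := by ring
  refine ⟨c, by omega, by rw [hN]; rwa [hlen] at hc2, by rw [hN']; exact hc3,
    fun W s u hs hu => ?_⟩
  have hsysU : ∀ i, wU (Fin.castAdd n i) ∉ Set.range sys := by
    rintro i ⟨j, hj⟩
    exact hUV i ⟨_, (hVs j).trans hj⟩
  have hsysV : ∀ i, wV (Fin.castAdd n i) ∉ Set.range sys := by
    rintro i ⟨j, hj⟩
    exact hVU i ⟨_, (hUs j).trans hj⟩
  have hfs : f ∉ Set.range sys := by
    rintro ⟨j, rfl⟩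
    exact hfU ⟨_, hUs j⟩
  have hreg : ∀ s : QubitBasis q, (∀ i, i ∉ Set.range sys → s i = 0) →
      s = setRegister idx f s (g 0) 0 := by
    intro s hs
    have h1 : s ∘ idx = g 0 := by
      rw [hg0]
      exact funext fun i => hs _ (Set.disjoint_left.1 hIs ⟨i, rfl⟩)
    rw [← h1, ← hs f hfs, setRegister_self]
  have hzero : ∀ s : QubitBasis q, (∀ i, i ∉ Set.range sys → s i = 0) → ∀ k i,
      i ∉ Set.range idx → i ∉ Set.range sys → setRegister idx f s (g k) 0 i = 0 := by
    intro s hs k i hi hi'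
    by_cases hif : i = f
    · rw [hif, setRegister_flag]
    · rw [setRegister_of_ne _ _ _ hi hif, hs i hi']
  have hsys : ∀ (s : QubitBasis q) k, setRegister idx f s (g k) 0 ∘ sys = s ∘ sys := by
    intro s k
    funext j
    exact setRegister_of_ne _ _ _ (fun h' => Set.disjoint_left.1 hIs h' ⟨j, rfl⟩)
      fun h' => hfs ⟨j, h'⟩
  have hPs' : ∀ s : QubitBasis q, (∀ i, i ∉ Set.range sys → s i = 0) →
      P *ᵥ Pi.single s 1 = ∑ j ∈ Finset.range K, (Real.sqrt (p j) : ℂ) •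
        Pi.single (setRegister idx f s (g j) 0) 1 := by
    intro s hs
    rw [← hPs s, ← hreg s hs]
  rw [hc]
  refine (conjTranspose_mul_mul_apply _ _ _ _ _ _ (hPs' s hs) (hPs' u hu)).trans ?_
  refine Finset.sum_congr rfl fun k hk => ?_
  have hk' := Finset.mem_range.1 hk
  have key : ∀ k', _ := fun k' => select_project_select_apply hd h hUs hVs hUV hVU hUw hVw
    (FU := fun s => FU W (s ∘ idx) (s f)) (indepOf_register_flag hfV hIV (FV W))
    (s := setRegister idx f s (g k) 0) (u := setRegister idx f u (g k') 0)
    (fun j => hzero s hs k _ (fun h' => Set.disjoint_left.1 hIw h' ⟨j, rfl⟩)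
      (Set.disjoint_left.1 hd ⟨j, rfl⟩))
    (fun j => hzero u hu k' _ (fun h' => Set.disjoint_left.1 hIw h' ⟨j, rfl⟩)
      (Set.disjoint_left.1 hd ⟨j, rfl⟩))
    (fun i => hzero s hs k _ (fun h' => Set.disjoint_left.1 hIU h' ⟨_, rfl⟩) (hsysU i))
    (fun i => hzero u hu k' _ (fun h' => Set.disjoint_left.1 hIU h' ⟨_, rfl⟩) (hsysU i))
    (fun i => hzero s hs k _ (fun h' => Set.disjoint_left.1 hIV h' ⟨_, rfl⟩) (hsysV i))
    (fun i => hzero u hu k' _ (fun h' => Set.disjoint_left.1 hIV h' ⟨_, rfl⟩) (hsysV i))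
  -- The operators between `P†` and `P` preserve the index register, so the cross terms `k' ≠ k`
  -- vanish and `√(p k) ^ 2 = p k` remains.
  rw [Finset.sum_eq_single k]
  · rw [key k, if_pos]
    · simp only [setRegister_comp hfI, setRegister_flag, hsys, hU W k hk', hV W k hk']
      rw [← Complex.ofReal_mul, Real.mul_self_sqrt (hp k)]
    · intro i hi
      by_cases hi' : i ∈ Set.range idx
      · obtain ⟨j, rfl⟩ := hi'
        have h1 := setRegister_comp (idx := idx) hfI s (g k) 0
        have h2 := setRegister_comp (idx := idx) hfI u (g k) 0
        exact congrFun (h1.trans h2.symm) j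
      · rw [hzero s hs k i hi' hi, hzero u hu k i hi' hi]
  · intro k' hk'' hne
    rw [key k', if_neg, mul_zero]
    intro H
    refine hne (hg (Finset.mem_range.1 hk'') hk' ?_)
    rw [← setRegister_comp (idx := idx) hfI s (g k) 0,
      ← setRegister_comp (idx := idx) hfI u (g k') 0]
    exact funext fun i => (H _ (Set.disjoint_left.1 hIs ⟨i, rfl⟩)).symm
  · exact fun h' => absurd hk h'

/-- The wires `d, d + 1, …`. -/
def shiftWires {m q : ℕ} (d : ℕ) (h : d + m ≤ q) : Fin m ↪ Fin q :=
  ⟨fun i => ⟨d + i, by omega⟩, fun i j hij => by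
    simp only [Fin.mk.injEq] at hij
    exact Fin.ext (by omega)⟩

theorem shiftWires_val {m q d : ℕ} (h : d + m ≤ q) (i : Fin m) :
    (shiftWires d h i : ℕ) = d + i := rfl

theorem mem_range_shiftWires {m q d : ℕ} (h : d + m ≤ q) (i : Fin q) :
    i ∈ Set.range (shiftWires d h) ↔ d ≤ i ∧ (i : ℕ) < d + m := by
  constructor
  · rintro ⟨j, rfl⟩
    rw [shiftWires_val]
    omega
  · intro hi
    exact ⟨⟨i - d, by omega⟩, Fin.ext (by rw [shiftWires_val]; dsimp only; omega)⟩

/-- The wires `d, …, d + a - 1` followed by the wires `e, …, e + n - 1`. -/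
def blockWires {a n q : ℕ} (d e : ℕ) (hde : d + a ≤ e) (he : e + n ≤ q) : Fin (a + n) ↪ Fin q :=
  ⟨Fin.append (shiftWires d (by omega)) (shiftWires e he), by
    rw [Fin.append_injective_iff]
    refine ⟨(shiftWires d _).injective, (shiftWires e he).injective, fun i j hij => ?_⟩
    have := congrArg Fin.val hij
    rw [shiftWires_val, shiftWires_val] at this
    omega⟩

theorem blockWires_natAdd {a n q d e : ℕ} (hde : d + a ≤ e) (he : e + n ≤ q) (j : Fin n) :
    blockWires d e hde he (Fin.natAdd a j) = shiftWires e he j :=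
  Fin.append_right _ _ j

theorem blockWires_castAdd {a n q d e : ℕ} (hde : d + a ≤ e) (he : e + n ≤ q) (i : Fin a) :
    blockWires d e hde he (Fin.castAdd n i) = shiftWires d (by omega) i :=
  Fin.append_left _ _ i

theorem mem_range_blockWires {a n q d e : ℕ} (hde : d + a ≤ e) (he : e + n ≤ q) (i : Fin q) :
    i ∈ Set.range (blockWires d e hde he) ↔
      (d ≤ i ∧ (i : ℕ) < d + a) ∨ (e ≤ i ∧ (i : ℕ) < e + n) := by
  have : Set.range (blockWires d e hde he) =
      Set.range (shiftWires (m := a) (q := q) d (by omega)) ∪ Set.range (shiftWires e he) := by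
    ext i
    constructor
    · rintro ⟨j, rfl⟩
      refine Fin.addCases (fun j => Or.inl ⟨j, ?_⟩) (fun j => Or.inr ⟨j, ?_⟩) j
      exacts [(blockWires_castAdd hde he j).symm, (blockWires_natAdd hde he j).symm]
    · rintro (⟨j, rfl⟩ | ⟨j, rfl⟩)
      exacts [⟨_, blockWires_castAdd hde he j⟩, ⟨_, blockWires_natAdd hde he j⟩]
  rw [this, Set.mem_union, mem_range_shiftWires, mem_range_shiftWires]

/-- The binary digits of `k`. -/
def bits (l k : ℕ) : QubitBasis l := fun i => if k.testBit i then 1 else 0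

theorem bits_zero (l : ℕ) : bits l 0 = 0 := by
  funext i
  simp [bits]

theorem injOn_bits {l K : ℕ} (h : K ≤ 2 ^ l) : Set.InjOn (bits l) (Set.Iio K) := by
  intro j hj k hk hjk
  refine Nat.eq_of_testBit_eq fun i => ?_
  by_cases hi : i < l
  · have := congrFun hjk ⟨i, hi⟩
    simp only [bits] at this
    generalize j.testBit i = x at *
    generalize k.testBit i = y at *
    revert this
    cases x <;> cases y <;> simp
  · have hil : 2 ^ l ≤ 2 ^ i := Nat.pow_le_pow_right two_pos (not_lt.1 hi)
    rw [Nat.testBit_lt_two_pow (lt_of_lt_of_le (lt_of_lt_of_le hj h) hil),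
      Nat.testBit_lt_two_pow (lt_of_lt_of_le (lt_of_lt_of_le hk h) hil)]

theorem exists_lcu_circuit (n a K : ℕ) (hn : 1 ≤ n) (p : ℕ → ℝ) (hp : ∀ k, 0 ≤ p k)
    (hp1 : ∑ k ∈ Finset.range (K + 1), p k = 1) :
    ∃ c : QCircuit ((2 * n + 2 * a + Nat.clog 2 (K + 1)) + n) (a + n)
        (Fin (K + 1) ⊕ Fin (K + 1)),
      c.calls ≤ 2 * (K + 1) ∧
      c.size ≤ n + 2 + (K + 1) * (6 * 4 ^ Nat.clog 2 (Nat.clog 2 (K + 1)) +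
        2 * Nat.clog 2 (K + 1)) ∧
      c.depth ≤ 3 + (K + 1) * (6 * 4 ^ Nat.clog 2 (Nat.clog 2 (K + 1)) +
        2 * Nat.clog 2 (K + 1)) ∧
      ∀ U V : Fin (K + 1) → QubitOp (a + n),
        zeroBlock (2 * n + 2 * a + Nat.clog 2 (K + 1)) n (QCircuit.toOp (Sum.elim U V) c) =
          ∑ k : Fin (K + 1), (p k : ℂ) • (zeroBlock a n (U k) *
            Matrix.of (fun _ _ => (1 / 2) ^ n) * zeroBlock a n (V k)) := by
  set l := Nat.clog 2 (K + 1) with hl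
  have e1 : (2 * n + 2 * a + l) + n ≤ (2 * n + 2 * a + l) + n := le_rfl
  obtain ⟨c, hc1, hc2, hc3, hc⟩ := exists_circuit_on_wires
    (q := (2 * n + 2 * a + l) + n) (n := n) (a := a) (K := K + 1)
    -- Layout: `n` wires for the projection, then `n` wires of which only the first is used, as the
    -- flag (hence `1 ≤ n`), then the ancillas of `U`, those of `V`, the index register and the
    -- system.
    (sw := shiftWires 0 (by omega)) (sys := shiftWires (2 * n + 2 * a + l) e1)
    (wU := blockWires (2 * n) (2 * n + 2 * a + l) (by omega) e1)
    (wV := blockWires (2 * n + a) (2 * n + 2 * a + l) (by omega) e1)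
    (idx := shiftWires (m := l) (2 * n + 2 * a) (by omega)) (f := ⟨n, by omega⟩)
    (Set.disjoint_left.2 fun i h h' => by rw [mem_range_shiftWires] at h h'; omega)
    (fun j => blockWires_natAdd _ _ j) (fun j => blockWires_natAdd _ _ j)
    (fun i => by
      rw [mem_range_blockWires, blockWires_castAdd, shiftWires_val]
      omega)
    (fun i => by
      rw [mem_range_blockWires, blockWires_castAdd, shiftWires_val]
      omega)
    (Set.disjoint_left.2 fun i h h' => by
      rw [mem_range_shiftWires] at h; rw [mem_range_blockWires] at h'; omega)
    (Set.disjoint_left.2 fun i h h' => by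
      rw [mem_range_shiftWires] at h; rw [mem_range_blockWires] at h'; omega)
    (Set.disjoint_left.2 fun i h h' => by
      rw [mem_range_shiftWires] at h; rw [mem_range_blockWires] at h'; omega)
    (Set.disjoint_left.2 fun i h h' => by
      rw [mem_range_shiftWires] at h; rw [mem_range_blockWires] at h'; omega)
    (Set.disjoint_left.2 fun i h h' => by rw [mem_range_shiftWires] at h h'; omega)
    (Set.disjoint_left.2 fun i h h' => by rw [mem_range_shiftWires] at h h'; omega)
    (by rw [mem_range_shiftWires]; dsimp only; omega)
    (by rw [mem_range_blockWires]; dsimp only; omega)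
    (by rw [mem_range_blockWires]; dsimp only; omega)
    (bits l) (injOn_bits (Nat.le_pow_clog one_lt_two (K + 1))) (bits_zero l) p hp hp1
    (fun k => Sum.inl (Fin.ofNat (K + 1) k)) (fun k => Sum.inr (Fin.ofNat (K + 1) k))
  refine ⟨c, hc1, hc2, hc3, fun U V => ?_⟩
  have hz : ∀ i : Fin (2 ^ n), ∀ j : Fin ((2 * n + 2 * a + l) + n),
      j ∉ Set.range (shiftWires (2 * n + 2 * a + l) e1) →
        zeroAncillaLabel (2 * n + 2 * a + l) n i j = 0 := by
    intro i j hj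
    rw [mem_range_shiftWires] at hj
    have : j = Fin.castAdd n ⟨j, by omega⟩ := rfl
    rw [this, zeroAncillaLabel, Fin.append_left]
  have hs : ∀ i : Fin (2 ^ n), zeroAncillaLabel (2 * n + 2 * a + l) n i ∘
      shiftWires (2 * n + 2 * a + l) e1 = finFunctionFinEquiv.symm i := by
    intro i
    funext j
    have : shiftWires (2 * n + 2 * a + l) e1 j = Fin.natAdd (2 * n + 2 * a + l) j := rfl
    rw [Function.comp_apply, this, zeroAncillaLabel, Fin.append_right]
  ext i j
  rw [zeroBlock, hc _ _ _ (hz i) (hz j), Matrix.sum_apply, Finset.sum_range]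
  refine Finset.sum_congr rfl fun k _ => ?_
  rw [Matrix.smul_apply, smul_eq_mul, hs, hs]
  have hk : Fin.ofNat (K + 1) (k : ℕ) = k := Fin.ext (Nat.mod_eq_of_lt k.isLt)
  simp only [hk, Sum.elim_inl, Sum.elim_inr]
  congr 1
  rw [Finset.sum_comm, Matrix.mul_apply, ← (finFunctionFinEquiv (m := 2) (n := n)).sum_comp]
  refine Finset.sum_congr rfl fun b' _ => ?_
  rw [Matrix.mul_apply, Finset.sum_mul, ← (finFunctionFinEquiv (m := 2) (n := n)).sum_comp]
  refine Finset.sum_congr rfl fun b _ => ?_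
  simp [zeroBlock, zeroAncillaLabel]

/-! ### Spectral norms -/

section Norms

open scoped Matrix.Norms.L2Operator

theorem l2_opNorm_le_one_of_conjTranspose_mul_self {m n : Type*} [Fintype m] [Fintype n]
    [DecidableEq m] [DecidableEq n] {A : Matrix m n ℂ} (h : Aᴴ * A = 1) : ‖A‖ ≤ 1 := by
  have h1 := Matrix.l2_opNorm_conjTranspose_mul_self A
  have h2 : ‖(1 : Matrix n n ℂ)‖ ≤ 1 := by
    rw [← Matrix.diagonal_one, Matrix.l2_opNorm_diagonal]
    exact (pi_norm_le_iff_of_nonneg zero_le_one).2 fun i => by simp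
  rw [h] at h1
  nlinarith [norm_nonneg A]

theorem zeroAncillaLabel_injective (a n : ℕ) : Function.Injective (zeroAncillaLabel a n) := by
  intro i j h
  refine finFunctionFinEquiv.symm.injective (funext fun k => ?_)
  have := congrFun h (Fin.natAdd a k)
  simpa [zeroAncillaLabel] using this

theorem norm_zeroBlock_le_one {a n : ℕ} {U : QubitOp (a + n)}
    (hU : U ∈ Matrix.unitaryGroup (QubitBasis (a + n)) ℂ) : ‖zeroBlock a n U‖ ≤ 1 := by
  let B : Matrix (QubitBasis (a + n)) (Fin (2 ^ n)) ℂ :=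
    Matrix.of fun s i => if s = zeroAncillaLabel a n i then 1 else 0
  have hB : Bᴴ * B = 1 := by
    ext i j
    simp [B, Matrix.mul_apply, Matrix.one_apply, (zeroAncillaLabel_injective a n).eq_iff,
      eq_comm (a := j)]
  -- `B` is the isometry that appends the zero ancillas; the block of a unitary is its compression
  -- by `B`, hence a contraction.
  have h : zeroBlock a n U = Bᴴ * (U * B) := by
    ext i j
    simp [B, Matrix.mul_apply, zeroBlock]
  have h1 := l2_opNorm_le_one_of_conjTranspose_mul_self hB
  have h2 : ‖U‖ ≤ 1 :=
    l2_opNorm_le_one_of_conjTranspose_mul_self (Matrix.mem_unitaryGroup_iff'.1 hU)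
  rw [h]
  calc ‖Bᴴ * (U * B)‖ ≤ ‖Bᴴ‖ * (‖U‖ * ‖B‖) :=
        (Matrix.l2_opNorm_mul _ _).trans
          (mul_le_mul_of_nonneg_left (Matrix.l2_opNorm_mul _ _) (norm_nonneg _))
    _ ≤ 1 * (1 * 1) := by
        rw [Matrix.l2_opNorm_conjTranspose]
        gcongr
    _ = 1 := by norm_num

/-- The projection on the uniform superposition. -/
noncomputable def uniformProjection (n : ℕ) : Matrix (Fin (2 ^ n)) (Fin (2 ^ n)) ℂ :=
  Matrix.of fun _ _ => (1 / 2) ^ n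

theorem norm_uniformProjection_le_one (n : ℕ) : ‖uniformProjection n‖ ≤ 1 := by
  have h : (uniformProjection n)ᴴ * uniformProjection n = uniformProjection n := by
    ext i j
    simp [uniformProjection, Matrix.mul_apply]
  have h1 := Matrix.l2_opNorm_conjTranspose_mul_self (uniformProjection n)
  rw [h] at h1
  nlinarith [norm_nonneg (uniformProjection n)]

theorem norm_diagOp_le_one {N : ℕ} {d : Fin N → ℝ} (hd : ∀ i, |d i| ≤ 1) : ‖diagOp d‖ ≤ 1 := by
  rw [diagOp, Matrix.l2_opNorm_diagonal]
  exact (pi_norm_le_iff_of_nonneg zero_le_one).2 fun i => by simpa using hd i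

theorem norm_mul_mul_le {N : ℕ} (A B C : Matrix (Fin N) (Fin N) ℂ) {a b c : ℝ} (hA : ‖A‖ ≤ a)
    (hB : ‖B‖ ≤ b) (hC : ‖C‖ ≤ c) : ‖A * B * C‖ ≤ a * b * c := by
  have ha := (norm_nonneg A).trans hA
  have hb := (norm_nonneg B).trans hB
  calc ‖A * B * C‖ ≤ ‖A‖ * ‖B‖ * ‖C‖ :=
        (norm_mul_le _ _).trans (mul_le_mul_of_nonneg_right (norm_mul_le _ _) (norm_nonneg _))
    _ ≤ a * b * c := by gcongr

/-- The coefficient is changed first, then the two outer factors one at a time. All remaining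
factors are contractions. -/
theorem norm_smul_sub_smul_le {N : ℕ} {D D' A A' J : Matrix (Fin N) (Fin N) ℂ} {c p δ : ℝ}
    (hp : 0 ≤ p) (hJ : ‖J‖ ≤ 1) (hD : ‖D‖ ≤ 1) (hD' : ‖D'‖ ≤ 1) (hA : ‖A‖ ≤ 1)
    (h : ‖D - A‖ ≤ δ) (h' : ‖D' - A'‖ ≤ δ) :
    ‖(c : ℂ) • (D * J * D') - (p : ℂ) • (A * J * A')‖ ≤ |c - p| + p * (2 * δ) := by
  have e : (c : ℂ) • (D * J * D') - (p : ℂ) • (A * J * A') =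
      ((c - p : ℝ) : ℂ) • (D * J * D') + (p : ℂ) • ((D - A) * J * D' + A * J * (D' - A')) := by
    rw [Complex.ofReal_sub, sub_smul, sub_mul, sub_mul, mul_sub, smul_add, smul_sub, smul_sub]
    abel
  rw [e]
  have h1 := norm_mul_mul_le D J D' hD hJ hD'
  have h2 := norm_mul_mul_le (D - A) J D' h hJ hD'
  have h3 := norm_mul_mul_le A J (D' - A') hA hJ h'
  refine (norm_add_le _ _).trans ?_
  rw [norm_smul, norm_smul, Complex.norm_real, Complex.norm_real, Real.norm_eq_abs,
    Real.norm_eq_abs, abs_of_nonneg hp]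
  have h4 := norm_add_le ((D - A) * J * D') (A * J * (D' - A'))
  gcongr
  · simpa using mul_le_mul_of_nonneg_left h1 (abs_nonneg (c - p))
  · linarith

/-! ### Truncated expansions -/

/-- The weights `c k / α`, `k < K`, with the remaining weight on `K`. -/
noncomputable def truncatedWeight (c : ℕ → ℝ) (α : ℝ) (K k : ℕ) : ℝ :=
  if k < K then c k / α else if k = K then (α - ∑ j ∈ Finset.range K, c j) / α else 0

theorem sum_truncatedWeight {c : ℕ → ℝ} {α : ℝ} (hα : 0 < α) (K : ℕ) :
    ∑ k ∈ Finset.range (K + 1), truncatedWeight c α K k = 1 := by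
  rw [Finset.sum_range_succ, Finset.sum_congr rfl fun k hk =>
    show truncatedWeight c α K k = c k / α from if_pos (Finset.mem_range.1 hk), ← Finset.sum_div]
  simp only [truncatedWeight, lt_irrefl, if_false, if_true]
  rw [← add_div, add_sub_cancel, div_self hα.ne']

theorem truncatedWeight_nonneg {c : ℕ → ℝ} {α : ℝ} (hα : 0 < α) (hc : ∀ k, 0 ≤ c k)
    (hsum : HasSum c α) (K k : ℕ) : 0 ≤ truncatedWeight c α K k := by
  unfold truncatedWeight
  split_ifs
  · exact div_nonneg (hc k) hα.le
  · exact div_nonneg (sub_nonneg.2 (sum_le_hasSum _ (fun i _ => hc i) hsum)) hα.le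
  · exact le_rfl

/-- Only at `k = K` can the weight exceed `c k / α`, by the tail over `α`. As the signed differences
sum to zero, this form shows that the absolute ones sum to twice the tail. -/
theorem abs_sub_truncatedWeight {c : ℕ → ℝ} {α : ℝ} (hα : 0 < α) (hc : ∀ k, 0 ≤ c k)
    (hsum : HasSum c α) (K k : ℕ) :
    |c k - α * truncatedWeight c α K k| = c k - α * truncatedWeight c α K k +
      if k = K then 2 * (α - ∑ j ∈ Finset.range (K + 1), c j) else 0 := by
  have h := sum_le_hasSum (Finset.range (K + 1)) (fun i _ => hc i) hsum
  unfold truncatedWeight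
  rcases lt_trichotomy k K with hk | rfl | hk
  · rw [if_pos hk, if_neg hk.ne, mul_div_cancel₀ _ hα.ne']
    simp
  · rw [if_neg (lt_irrefl k), if_pos rfl, if_pos rfl, mul_div_cancel₀ _ hα.ne']
    rw [Finset.sum_range_succ] at h ⊢
    rw [abs_of_nonpos (by linarith)]
    ring
  · rw [if_neg hk.not_gt, if_neg hk.ne', if_neg hk.ne', mul_zero, sub_zero, add_zero,
      abs_of_nonneg (hc k)]

theorem norm_sub_truncated_le {n K : ℕ} {α ε : ℝ} (hα : 0 < α)
    {d d' : ℕ → Fin (2 ^ n) → ℝ} (hd : ∀ k i, |d k i| ≤ 1) (hd' : ∀ k i, |d' k i| ≤ 1)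
    {c : ℕ → ℝ} (hc : ∀ k, 0 ≤ c k) (hsum : HasSum c α) {E : Fin (2 ^ n) → Fin (2 ^ n) → ℝ}
    (hE : ∀ i j, HasSum (fun k => c k * d k i * d' k j) (E i j))
    (htail : α - ∑ k ∈ Finset.range (K + 1), c k ≤ ε / 3)
    (A A' : Fin (K + 1) → Matrix (Fin (2 ^ n)) (Fin (2 ^ n)) ℂ) (hA : ∀ k, ‖A k‖ ≤ 1)
    (h : ∀ k : Fin (K + 1), ‖diagOp (d k) - A k‖ ≤ ε / (6 * α))
    (h' : ∀ k : Fin (K + 1), ‖diagOp (d' k) - A' k‖ ≤ ε / (6 * α)) :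
    ‖(Matrix.of fun i j => ((E i j / (2 : ℝ) ^ n : ℝ) : ℂ)) - (α : ℂ) •
      ∑ k : Fin (K + 1), (truncatedWeight c α K k : ℂ) • (A k * uniformProjection n * A' k)‖
      ≤ ε := by
  set p := truncatedWeight c α K with hp
  have hp0 : ∀ k, 0 ≤ p k := truncatedWeight_nonneg hα hc hsum K
  let B : ℕ → Matrix (Fin (2 ^ n)) (Fin (2 ^ n)) ℂ := fun k =>
    A (Fin.ofNat (K + 1) k) * uniformProjection n * A' (Fin.ofNat (K + 1) k)
  have hpK : ∀ k, k ∉ Finset.range (K + 1) → p k = 0 := by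
    intro k hk
    rw [Finset.mem_range, not_lt] at hk
    rw [hp, truncatedWeight, if_neg (by omega), if_neg (by omega)]
  have hof : ∀ k : Fin (K + 1), Fin.ofNat (K + 1) (k : ℕ) = k :=
    fun k => Fin.ext (Nat.mod_eq_of_lt k.isLt)
  have h2 : HasSum (fun k => ((α * p k : ℝ) : ℂ) • B k) ((α : ℂ) •
      ∑ k : Fin (K + 1), (p k : ℂ) • (A k * uniformProjection n * A' k)) := by
    have e : (α : ℂ) • ∑ k : Fin (K + 1), (p k : ℂ) • (A k * uniformProjection n * A' k) =
        ∑ k ∈ Finset.range (K + 1), ((α * p k : ℝ) : ℂ) • B k := by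
      rw [Finset.sum_range, Finset.smul_sum]
      refine Finset.sum_congr rfl fun k _ => ?_
      rw [smul_smul, Complex.ofReal_mul]
      simp only [B, hof]
    rw [e]
    exact hasSum_sum_of_ne_finset_zero fun k hk => by simp [hpK k hk]
  have h1 : HasSum (fun k => (c k : ℂ) • (diagOp (d k) * uniformProjection n * diagOp (d' k)))
      (Matrix.of fun i j => ((E i j / (2 : ℝ) ^ n : ℝ) : ℂ)) := by
    -- Convergence of matrices is checked entrywise; the operator norm enters only in the termwise
    -- bound below.
    refine Pi.hasSum.2 fun i => Pi.hasSum.2 fun j => ?_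
    have := ((hE i j).div_const ((2 : ℝ) ^ n))
    have := Complex.hasSum_ofReal.2 this
    rw [Matrix.of_apply]
    convert this using 1
    funext k
    simp [diagOp, uniformProjection, Matrix.mul_diagonal, Matrix.diagonal_mul]
    ring
  have hsub := h1.sub h2
  have hb : HasSum (fun k => |c k - α * p k| + α * p k * (2 * (ε / (6 * α))))
      (α - α + 2 * (α - ∑ j ∈ Finset.range (K + 1), c j) + α * (2 * (ε / (6 * α)))) := by
    have hps : HasSum (fun k => α * p k) α := by
      have := hasSum_sum_of_ne_finset_zero (f := p) (L := .unconditional ℕ) hpK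
      rw [hp, sum_truncatedWeight hα, ← hp] at this
      simpa using this.mul_left α
    simp_rw [hp, abs_sub_truncatedWeight hα hc hsum, ← hp]
    exact ((hsum.sub hps).add (hasSum_ite_eq K _)).add (hps.mul_right _)
  have := hsub.norm_le_of_bounded hb ?_
  · refine this.trans ?_
    have e : α * (2 * (ε / (6 * α))) = ε / 3 := by
      field_simp
      ring
    rw [e]
    linarith
  · intro k
    by_cases hk : k ∈ Finset.range (K + 1)
    · have e : ((Fin.ofNat (K + 1) k : Fin (K + 1)) : ℕ) = k :=
        Nat.mod_eq_of_lt (Finset.mem_range.1 hk)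
      have hk1 := h (Fin.ofNat (K + 1) k)
      have hk2 := h' (Fin.ofNat (K + 1) k)
      rw [e] at hk1 hk2
      exact norm_smul_sub_smul_le (mul_nonneg hα.le (hp0 k)) (norm_uniformProjection_le_one n)
        (norm_diagOp_le_one (hd k)) (norm_diagOp_le_one (hd' k)) (hA _) hk1 hk2
    · rw [hpK k hk]
      have := norm_mul_mul_le _ _ _ (norm_diagOp_le_one (hd k)) (norm_uniformProjection_le_one n)
        (norm_diagOp_le_one (hd' k))
      simp only [mul_zero, Complex.ofReal_zero, zero_smul, sub_zero, zero_mul, add_zero]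
      rw [norm_smul, Complex.norm_real, Real.norm_eq_abs]
      simpa using mul_le_mul_of_nonneg_left this (abs_nonneg (c k))

end Norms

/-! ### Resources -/

theorem clog_succ_le {K : ℕ} (hK : 1 ≤ K) : (Nat.clog 2 (K + 1) : ℝ) ≤ 2 * (1 + Real.log K) := by
  have h1 : Nat.clog 2 (K + 1) ≤ Nat.log 2 K + 1 :=
    Nat.clog_le_of_le_pow (Nat.lt_pow_succ_log_self one_lt_two K)
  have h2 : ((2 : ℝ) ^ Nat.log 2 K) ≤ K := by
    exact_mod_cast Nat.pow_log_le_self 2 (by omega)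
  have h3 := Real.log_le_log (by positivity) h2
  rw [Real.log_pow] at h3
  have h4 := Real.log_two_gt_d9
  have h5 : (Nat.clog 2 (K + 1) : ℝ) ≤ Nat.log 2 K + 1 := by exact_mod_cast h1
  have h6 : (0 : ℝ) ≤ Nat.log 2 K := Nat.cast_nonneg _
  nlinarith

/-- With `l ≤ 2 * (1 + log K)`, the constant is `2 * 26 * 4 = 208`, from `K + 1 ≤ 2 * K` and `6 * 4
* l ^ 2 + 2 * l ≤ 26 * l ^ 2`. The additive terms `n + 2` and `3` later raise it to `211`. -/
theorem gate_count_le {K : ℕ} (hK : 1 ≤ K) :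
    (((K + 1) * (6 * 4 ^ Nat.clog 2 (Nat.clog 2 (K + 1)) + 2 * Nat.clog 2 (K + 1)) : ℕ) : ℝ) ≤
      208 * (K * (1 + Real.log K) ^ 2) := by
  have hl : 1 ≤ Nat.clog 2 (K + 1) := Nat.clog_pos one_lt_two (by omega)
  have h1 := four_pow_clog_le hl
  have h2 := clog_succ_le hK
  set l := Nat.clog 2 (K + 1)
  have h3 : (K + 1) * (6 * 4 ^ Nat.clog 2 l + 2 * l) ≤ (2 * K) * (26 * l ^ 2) :=
    Nat.mul_le_mul (by omega) (by nlinarith)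
  have h4 : (l : ℝ) ^ 2 ≤ (2 * (1 + Real.log K)) ^ 2 := pow_le_pow_left₀ (Nat.cast_nonneg _) h2 2
  have h5 : (((K + 1) * (6 * 4 ^ Nat.clog 2 l + 2 * l) : ℕ) : ℝ) ≤
      ((2 * K * (26 * l ^ 2) : ℕ) : ℝ) := Nat.cast_le.2 h3
  refine h5.trans ?_
  push_cast
  have h6 : (0 : ℝ) ≤ K := Nat.cast_nonneg _
  nlinarith [mul_le_mul_of_nonneg_left h4 h6]

theorem blockEncodable_of_expansion {n K : ℕ} (a : ℕ) {α ε : ℝ} (hn : 1 ≤ n) (hK : 1 ≤ K)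
    (hα : 0 < α) {d d' : ℕ → Fin (2 ^ n) → ℝ} (hd : ∀ k i, |d k i| ≤ 1)
    (hd' : ∀ k i, |d' k i| ≤ 1) {c : ℕ → ℝ} (hc : ∀ k, 0 ≤ c k) (hsum : HasSum c α)
    {E : Fin (2 ^ n) → Fin (2 ^ n) → ℝ}
    (hE : ∀ i j, HasSum (fun k => c k * d k i * d' k j) (E i j))
    (htail : α - ∑ k ∈ Finset.range (K + 1), c k ≤ ε / 3) :
    BlockEncodableFromDiagonals a K α ε 211 2 (fun k => diagOp (d k)) (fun k => diagOp (d' k))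
      (Matrix.of fun i j => ((E i j / (2 : ℝ) ^ n : ℝ) : ℂ)) := by
  obtain ⟨C, h1, h2, h3, h4⟩ := exists_lcu_circuit n a K hn (truncatedWeight c α K)
    (truncatedWeight_nonneg hα hc hsum K) (sum_truncatedWeight hα K)
  have hK' : (1 : ℝ) ≤ K := by exact_mod_cast hK
  have hn' : (1 : ℝ) ≤ n := by exact_mod_cast hn
  have hlK := Real.log_nonneg hK'
  have hln := Real.log_nonneg hn'
  have hL : (1 : ℝ) ≤ K * (1 + Real.log K) ^ 2 :=
    one_le_mul_of_one_le_of_one_le hK' (one_le_pow₀ (by linarith))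
  have hG := gate_count_le hK
  refine ⟨C, ?_, ?_, ?_, fun U V hU hV => ⟨?_, ?_⟩⟩
  · have : (C.calls : ℝ) ≤ ((2 * (K + 1) : ℕ) : ℝ) := Nat.cast_le.2 h1
    push_cast at this
    linarith
  · have h2' := Nat.cast_le (α := ℝ).2 h2
    rw [Nat.cast_add] at h2'
    have e : ((n + 2 : ℕ) : ℝ) ≤ 3 * n := by push_cast; linarith
    calc (C.size : ℝ) ≤ 211 * (n * (K * (1 + Real.log K) ^ 2)) := by nlinarith
      _ = 211 * (n * K) * (1 + Real.log K) ^ 2 := by ring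
  · have h3' := Nat.cast_le (α := ℝ).2 h3
    rw [Nat.cast_add] at h3'
    calc (C.depth : ℝ) ≤ 211 * ((1 + Real.log n) * (K * (1 + Real.log K) ^ 2)) := by
          push_cast at h3' hG ⊢
          nlinarith
      _ = 211 * ((1 + Real.log n) * K) * (1 + Real.log K) ^ 2 := by ring
  · refine QCircuit.toOp_mem_unitaryGroup ?_ C
    rintro (k | k)
    exacts [(hU k).1, (hV k).1]
  · rw [h4 U V]
    refine norm_sub_truncated_le hα hd hd' hc hsum hE htail (fun k => zeroBlock a n (U k))
      (fun k => zeroBlock a n (V k)) (fun k => norm_zeroBlock_le_one (hU k).1)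
      (fun k => ?_) (fun k => ?_)
    · have := (hU k).2
      rwa [Complex.ofReal_one, one_smul] at this
    · have := (hV k).2
      rwa [Complex.ofReal_one, one_smul] at this

/-! ### Exponential series -/

theorem hasSum_exp_series (z : ℝ) :
    HasSum (fun k : ℕ => z ^ k / (k.factorial : ℝ)) (Real.exp z) := by
  rw [Real.exp_eq_exp_ℝ]
  exact NormedSpace.expSeries_div_hasSum_exp z

/-- Since `m! * j! ≤ (m + j)!`, the shifted tail is dominated by `z ^ m / m!` times the full series.
-/
theorem exp_sub_sum_le {z : ℝ} (hz : 0 ≤ z) (m : ℕ) :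
    Real.exp z - ∑ k ∈ Finset.range m, z ^ k / (k.factorial : ℝ) ≤
      z ^ m / (m.factorial : ℝ) * Real.exp z := by
  have h1 := (hasSum_nat_add_iff' m).2 (hasSum_exp_series z)
  have h2 := (hasSum_exp_series z).mul_left (z ^ m / (m.factorial : ℝ))
  refine hasSum_le (fun j => ?_) h1 h2
  have h3 : ((m.factorial * j.factorial : ℕ) : ℝ) ≤ ((j + m).factorial : ℝ) := by
    rw [add_comm j m]
    exact_mod_cast Nat.le_of_dvd (Nat.factorial_pos _)
      (Nat.factorial_mul_factorial_dvd_factorial_add m j)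
  rw [div_mul_div_comm, ← pow_add, add_comm j m] at *
  push_cast at h3
  have h4 : (0 : ℝ) < m.factorial * j.factorial := by
    exact_mod_cast Nat.mul_pos m.factorial_pos j.factorial_pos
  exact div_le_div_of_nonneg_left (by positivity) h4 h3

theorem pow_div_factorial_le {z : ℝ} (hz : 0 ≤ z) {m : ℕ} (hm : 1 ≤ m) :
    z ^ m / (m.factorial : ℝ) ≤ (z / m) ^ m * Real.exp m := by
  have hm' : (0 : ℝ) < m := by exact_mod_cast hm
  have h := Real.pow_div_factorial_le_exp (x := (m : ℝ)) hm'.le m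
  have e : z ^ m / (m.factorial : ℝ) = (z / m) ^ m * ((m : ℝ) ^ m / (m.factorial : ℝ)) := by
    rw [div_pow]
    field_simp
  rw [e]
  exact mul_le_mul_of_nonneg_left h (by positivity)

/-! ### The truncation order -/

theorem log_le_sqrt {w : ℝ} (hw : 0 < w) : Real.log w ≤ Real.sqrt w := by
  have hv := Real.sqrt_pos.2 hw
  have he : (2 : ℝ) ≤ Real.exp 1 := by linarith [Real.exp_one_gt_d9]
  have h := Real.log_le_sub_one_of_pos (div_pos hv (Real.exp_pos 1))
  rw [Real.log_div hv.ne' (Real.exp_pos 1).ne', Real.log_exp, Real.log_sqrt hw.le] at h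
  have h2 : Real.sqrt w / Real.exp 1 ≤ Real.sqrt w / 2 :=
    div_le_div_of_nonneg_left hv.le two_pos he
  linarith

/-- With `v = √(e + r)` and `log (e + r) ≤ v`, the quotient is at least `r / v = v - e / v`. The
claim then reduces to `e ≤ v ^ 2 / 2 + v`. -/
theorem sqrt_le_one_add_div_log {r : ℝ} (hr : 0 ≤ r) :
    Real.sqrt (Real.exp 1 + r) / 2 ≤ 1 + r / Real.log (Real.exp 1 + r) := by
  have he1 := Real.exp_one_gt_d9
  have he2 := Real.exp_one_lt_d9
  have hw : 0 < Real.exp 1 + r := by linarith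
  have hlog : 1 ≤ Real.log (Real.exp 1 + r) := by
    rw [Real.le_log_iff_exp_le hw]
    linarith
  have hv := Real.sqrt_pos.2 hw
  have hsq := Real.sq_sqrt hw.le
  have h1 : r / Real.sqrt (Real.exp 1 + r) ≤ r / Real.log (Real.exp 1 + r) :=
    div_le_div_of_nonneg_left hr (by linarith) (log_le_sqrt hw)
  set v := Real.sqrt (Real.exp 1 + r)
  have hv1 : 1.5 ≤ v := by nlinarith
  have h2 : v / 2 - 1 ≤ r / v := by
    rw [le_div_iff₀ hv]
    nlinarith
  linarith

theorem tail_le_of_truncation {z ε : ℝ} (hz : 0 < z) (hε : 0 < ε) (hε1 : ε < 1) {m : ℕ}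
    (hm2 : 2 ≤ m)
    (hm : 16 * (z + Real.log (1 / ε) / Real.log (Real.exp 1 + Real.log (1 / ε) / z)) ≤ m) :
    z ^ m / (m.factorial : ℝ) * Real.exp (2 * z) ≤ ε / 3 := by
  have hL : 0 < Real.log (1 / ε) := Real.log_pos (by rw [lt_div_iff₀ hε]; linarith)
  have hLε : Real.exp (-Real.log (1 / ε)) = ε := by
    rw [one_div, Real.log_inv, neg_neg, Real.exp_log hε]
  set L := Real.log (1 / ε)
  set w := Real.exp 1 + L / z with hw
  have hr : 0 < L / z := div_pos hL hz
  have he1 := Real.exp_one_gt_d9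
  have hwpos : 0 < w := by linarith
  have hlog : 1 ≤ Real.log w := by
    rw [Real.le_log_iff_exp_le hwpos]
    linarith
  have hm' : (2 : ℝ) ≤ m := by exact_mod_cast hm2
  have hLw : 0 < L / Real.log w := div_pos hL (by linarith)
  have hv := Real.sqrt_pos.2 hwpos
  -- The scale equals `z * (1 + r / log w)` with `r = L / z`, which is at least `z * √w / 2`. So `z
  -- / m` is below `1 / (8 * √w)`, small enough to absorb the factors `e ^ m` and `e ^ (2 * z)`.
  have h8 : z * (8 * Real.sqrt w) ≤ m := by
    have h := mul_le_mul_of_nonneg_left (sqrt_le_one_add_div_log hr.le) hz.le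
    have e : z * (1 + L / z / Real.log w) = z + L / Real.log w := by field_simp
    rw [← hw, e] at h
    linarith
  have h1 : z / m ≤ Real.exp (-(3 * Real.log 2 + Real.log w / 2)) := by
    have e : Real.exp (3 * Real.log 2 + Real.log w / 2) = 8 * Real.sqrt w := by
      rw [← Real.log_sqrt hwpos.le, Real.exp_add, Real.exp_log hv, mul_comm 3, Real.exp_mul,
        Real.exp_log two_pos]
      norm_num
    rw [Real.exp_neg, e, div_le_iff₀ (by linarith), inv_mul_eq_div, le_div_iff₀ (by positivity)]
    exact h8
  have h2 : (z / m) ^ m ≤ Real.exp (m * -(3 * Real.log 2 + Real.log w / 2)) := by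
    rw [Real.exp_nat_mul]
    exact pow_le_pow_left₀ (by positivity) h1 m
  have h3 : m * Real.log w ≥ 16 * L := by
    have h := mul_le_mul_of_nonneg_right (show 16 * (L / Real.log w) ≤ m by linarith)
      (show 0 ≤ Real.log w by linarith)
    rwa [mul_assoc, div_mul_cancel₀ _ (by linarith : Real.log w ≠ 0)] at h
  have hl2 := Real.log_two_gt_d9
  have hl3 : Real.log 3 ≤ 1.25 := by
    have h := Real.log_le_sub_one_of_pos (show (0 : ℝ) < 3 / 2 by norm_num)
    rw [Real.log_div (by norm_num) (by norm_num)] at h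
    linarith [Real.log_two_lt_d9]
  calc z ^ m / (m.factorial : ℝ) * Real.exp (2 * z)
      ≤ (z / m) ^ m * Real.exp m * Real.exp (2 * z) :=
        mul_le_mul_of_nonneg_right (pow_div_factorial_le hz.le (by omega)) (Real.exp_pos _).le
    _ ≤ Real.exp (m * -(3 * Real.log 2 + Real.log w / 2)) * Real.exp m * Real.exp (2 * z) := by
        gcongr
    _ = Real.exp (m * -(3 * Real.log 2 + Real.log w / 2) + m + 2 * z) := by
        rw [Real.exp_add, Real.exp_add]
    _ ≤ Real.exp (-L - Real.log 3) := by
        refine Real.exp_le_exp.2 ?_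
        -- Here `m * log w / 2 ≥ 8 * L` yields `-L`. As `z ≤ m / 16`, the rest is at most `m * (1 -
        -- 3 * log 2 + 1 / 8)`, which is below `-log 3` because `m ≥ 2`.
        nlinarith
    _ = ε / 3 := by rw [Real.exp_sub, hLε, Real.exp_log (by norm_num)]

/-! ### Bessel functions and the Jacobi-Anger expansion -/

/-- The series is compared termwise with `(|w| / 2) ^ k / k!` times that of `cosh w`. This rests on
`k! * (2 m)! ≤ 4 ^ m * m! * (m + k)!`, a consequence of `(2 m).choose m ≤ 4 ^ m`. -/
theorem abs_besselI_le (k : ℕ) (w : ℝ) :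
    |besselI k w| ≤ (|w| / 2) ^ k / (k.factorial : ℝ) * Real.exp |w| := by
  have h1 := (Real.hasSum_cosh w).mul_left ((|w| / 2) ^ k / (k.factorial : ℝ))
  have h2 := (summable_besselI k w).hasSum
  have h3 := h2.norm_le_of_bounded h1 fun m => ?_
  · refine h3.trans (mul_le_mul_of_nonneg_left ?_ (by positivity))
    rw [← Real.cosh_abs, Real.cosh_eq]
    have := Real.exp_le_exp.2 (neg_le_self (abs_nonneg w))
    linarith
  · have hc : (2 * m).factorial ≤ 4 ^ m * (m.factorial * m.factorial) := by
      have h4 := Nat.choose_mul_factorial_mul_factorial (show m ≤ 2 * m by omega)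
      have h5 := Nat.choose_le_two_pow (2 * m) m
      rw [pow_mul] at h5
      norm_num at h5
      rw [show 2 * m - m = m by omega, mul_assoc] at h4
      rw [← h4]
      exact Nat.mul_le_mul_right _ h5
    have hf : k.factorial * (2 * m).factorial ≤ 4 ^ m * (m.factorial * (m + k).factorial) := by
      have h6 := Nat.le_of_dvd (Nat.factorial_pos _)
        (Nat.factorial_mul_factorial_dvd_factorial_add m k)
      calc k.factorial * (2 * m).factorial
          ≤ k.factorial * (4 ^ m * (m.factorial * m.factorial)) := Nat.mul_le_mul_left _ hc
        _ = 4 ^ m * (m.factorial * (m.factorial * k.factorial)) := by ring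
        _ ≤ _ := by gcongr
    have hf' : (k.factorial : ℝ) * ((2 * m).factorial : ℝ) ≤
        4 ^ m * ((m.factorial : ℝ) * ((m + k).factorial : ℝ)) := by exact_mod_cast hf
    rw [Real.norm_eq_abs, abs_div, abs_pow, abs_div, abs_of_pos (two_pos : (0 : ℝ) < 2),
      abs_of_pos (by positivity : (0 : ℝ) < (m.factorial : ℝ) * ((m + k).factorial : ℝ)),
      div_mul_div_comm, div_le_div_iff₀ (by positivity) (by positivity),
      ← (even_two_mul m).pow_abs w]
    have e1 : (|w| / 2) ^ (2 * m + k) = |w| ^ (2 * m) * (|w| / 2) ^ k / 4 ^ m := by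
      rw [pow_add, div_pow |w| 2 (2 * m), pow_mul 2 2 m]
      norm_num
      ring
    rw [e1]
    have h7 : (0 : ℝ) ≤ |w| ^ (2 * m) * (|w| / 2) ^ k / 4 ^ m := by positivity
    refine (mul_le_mul_of_nonneg_left hf' h7).trans (le_of_eq ?_)
    field_simp

theorem hasSum_jacobi_anger (w θ : ℝ) :
    HasSum (fun k : ℕ => (if k = 0 then 1 else 2) * besselI k w * Real.cos (k * θ))
      (Real.exp (w * Real.cos θ)) := by
  let F : ℕ × ℕ → ℝ := fun p =>
    (w / 2) ^ (p.1 + p.2) / ((p.1.factorial : ℝ) * (p.2.factorial : ℝ)) *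
      Real.cos (((p.1 : ℝ) - p.2) * θ)
  have hF : HasSum F (Real.exp (w * Real.cos θ)) := by
    -- Since `a + b = w * cos θ`, the double series `F` is the real part of the product of the
    -- series of `exp a` and `exp b`.
    let a : ℂ := (w / 2 : ℝ) * Complex.exp (θ * Complex.I)
    let b : ℂ := (w / 2 : ℝ) * Complex.exp (-(θ * Complex.I))
    have hs := summable_mul_of_summable_norm (f := fun k : ℕ => a ^ k / (k.factorial : ℂ))
      (g := fun k : ℕ => b ^ k / (k.factorial : ℂ)) (NormedSpace.norm_expSeries_div_summable a)
      (NormedSpace.norm_expSeries_div_summable b)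
    have h := (NormedSpace.expSeries_div_hasSum_exp a).mul
      (NormedSpace.expSeries_div_hasSum_exp b) hs
    rw [← Complex.exp_eq_exp_ℂ, ← Complex.exp_add] at h
    have hab : a + b = ((w * Real.cos θ : ℝ) : ℂ) := by
      simp only [a, b]
      rw [Complex.ofReal_mul, Complex.ofReal_cos, Complex.cos]
      push_cast
      ring_nf
    rw [hab] at h
    have h' := Complex.hasSum_re h
    rw [Complex.exp_ofReal_re] at h'
    convert h' using 1
    funext p
    have e : a ^ p.1 / (p.1.factorial : ℂ) * (b ^ p.2 / (p.2.factorial : ℂ)) =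
        (((w / 2) ^ (p.1 + p.2) / ((p.1.factorial : ℝ) * (p.2.factorial : ℝ)) : ℝ) : ℂ) *
          Complex.exp (((((p.1 : ℝ) - p.2) * θ : ℝ) : ℂ) * Complex.I) := by
      simp only [a, b]
      rw [mul_pow, mul_pow, ← Complex.exp_nat_mul, ← Complex.exp_nat_mul]
      have : Complex.exp (((((p.1 : ℝ) - p.2) * θ : ℝ) : ℂ) * Complex.I) =
          Complex.exp (p.1 * (θ * Complex.I)) * Complex.exp (p.2 * (-(θ * Complex.I))) := by
        rw [← Complex.exp_add]
        congr 1
        push_cast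
        ring
      rw [this]
      push_cast
      rw [pow_add]
      ring
    rw [e, Complex.re_ofReal_mul, Complex.exp_ofReal_mul_I_re]
  -- The exponent pairs are split by the sign of `p.1 - p.2`: `g₁` covers difference `k ≥ 0` and
  -- `g₂` difference `-(k + 1)`. The fibre over a difference `±k` sums to `besselI k w * cos (k θ)`,
  -- so each `k ≥ 1` occurs twice.
  let g₁ : ℕ × ℕ → ℕ × ℕ := fun p => (p.2 + p.1, p.2)
  let g₂ : ℕ × ℕ → ℕ × ℕ := fun p => (p.2, p.2 + (p.1 + 1))
  have hg₁ : Function.Injective g₁ := by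
    rintro ⟨a, b⟩ ⟨c, d⟩ h
    simp only [g₁, Prod.mk.injEq] at h ⊢
    omega
  have hg₂ : Function.Injective g₂ := by
    rintro ⟨a, b⟩ ⟨c, d⟩ h
    simp only [g₂, Prod.mk.injEq] at h ⊢
    omega
  have hr : (Set.range g₁)ᶜ = Set.range g₂ := by
    ext ⟨a, b⟩
    simp only [Set.mem_compl_iff, Set.mem_range, Prod.exists, g₁, g₂, Prod.mk.injEq, not_exists]
    constructor
    · intro h
      refine ⟨b - a - 1, a, rfl, ?_⟩
      have := h (a - b) b
      omega
    · rintro ⟨c, d, h⟩ e f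
      omega
  have hs₁ := hF.summable.comp_injective hg₁
  have hs₂ := hF.summable.comp_injective hg₂
  have hS : (∑' p, F (g₁ p)) + ∑' p, F (g₂ p) = Real.exp (w * Real.cos θ) := by
    have h1 : HasSum ((Set.range g₁).indicator F) (∑' p, F (g₁ p)) := by
      refine (hg₁.hasSum_iff fun x hx => Set.indicator_of_notMem hx F).1 ?_
      convert! hs₁.hasSum using 1
      funext p
      exact Set.indicator_of_mem (Set.mem_range_self p) F
    have h2 : HasSum ((Set.range g₁)ᶜ.indicator F) (∑' p, F (g₂ p)) := by
      rw [hr]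
      refine (hg₂.hasSum_iff fun x hx => Set.indicator_of_notMem hx F).1 ?_
      convert! hs₂.hasSum using 1
      funext p
      exact Set.indicator_of_mem (Set.mem_range_self p) F
    have h3 := h1.add h2
    simp_rw [← Pi.add_apply, Set.indicator_self_add_compl] at h3
    exact h3.unique hF
  have hB : ∀ k : ℕ, HasSum (fun m => F (g₁ (k, m))) (besselI k w * Real.cos (k * θ)) := by
    intro k
    have := (summable_besselI k w).hasSum.mul_right (Real.cos (k * θ))
    convert! this using 1
    funext m
    simp only [F, g₁]
    rw [mul_comm (((m + k).factorial : ℕ) : ℝ), show m + k + m = 2 * m + k by ring]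
    push_cast
    rw [add_sub_cancel_left]
  have hB' : ∀ k : ℕ, HasSum (fun m => F (g₂ (k, m)))
      (besselI (k + 1) w * Real.cos ((k + 1 : ℕ) * θ)) := by
    intro k
    have := (summable_besselI (k + 1) w).hasSum.mul_right (Real.cos ((k + 1 : ℕ) * θ))
    convert! this using 1
    funext m
    simp only [F, g₂]
    rw [show m + (m + (k + 1)) = 2 * m + (k + 1) by ring, Nat.cast_add m, sub_add_cancel_left,
      neg_mul, Real.cos_neg]
  have hT₁ := HasSum.prod_fiberwise hs₁.hasSum hB
  have hT₂ := HasSum.prod_fiberwise hs₂.hasSum hB'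
  have hT₂' := HasSum.zero_add (f := fun k => if k = 0 then 0 else
    besselI k w * Real.cos (k * θ)) (by simpa using hT₂)
  have hT := hT₁.add hT₂'
  simp only [if_true, zero_add] at hT
  rw [← hS]
  convert! hT using 1
  funext k
  split_ifs <;> ring

/-! ### The two expansions of the Laplace kernel -/

theorem hasSum_of_forall_eq {ι : Type*} {f g : ι → ℝ} {s : ℝ} (h : ∀ k, f k = g k)
    (hf : HasSum f s) : HasSum g s := by
  rwa [← funext h]

theorem abs_le_maxAbs {N : ℕ} (v : Fin N → ℝ) (i : Fin N) : |v i| ≤ maxAbs v :=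
  le_ciSup (f := fun i => |v i|) (Set.finite_range _).bddAbove i

theorem abs_div_maxAbs_le_one {N : ℕ} {v : Fin N → ℝ} (hv : 0 < maxAbs v) (i : Fin N) :
    |v i / maxAbs v| ≤ 1 := by
  rw [abs_div, abs_of_pos hv, div_le_one hv]
  exact abs_le_maxAbs v i

theorem pow_div_factorial_mul_exp_mono {z : ℝ} (hz : 0 ≤ z) (m : ℕ) :
    z ^ m / (m.factorial : ℝ) * Real.exp z ≤ z ^ m / (m.factorial : ℝ) * Real.exp (2 * z) :=
  mul_le_mul_of_nonneg_left (Real.exp_le_exp.2 (by linarith)) (by positivity)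

theorem blockEncodable_taylor {n K : ℕ} (a : ℕ) {ε : ℝ} {x y : Fin (2 ^ n) → ℝ} (hn : 1 ≤ n)
    (hK : 1 ≤ K) (hx : 0 < maxAbs x) (hy : 0 < maxAbs y)
    (htail : (maxAbs x * maxAbs y) ^ (K + 1) / ((K + 1).factorial : ℝ) *
      Real.exp (2 * (maxAbs x * maxAbs y)) ≤ ε / 3) :
    BlockEncodableFromDiagonals a K (Real.exp (maxAbs x * maxAbs y)) ε 211 2
      (powerDiag x) (powerDiag y) (qlt x y) := by
  have hz := mul_pos hx hy
  refine blockEncodable_of_expansion a hn hK (Real.exp_pos _)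
    (d := fun k i => (x i / maxAbs x) ^ k) (d' := fun k j => (y j / maxAbs y) ^ k)
    (fun k i => ?_) (fun k j => ?_) (c := fun k => (maxAbs x * maxAbs y) ^ k / (k.factorial : ℝ))
    (fun k => by positivity) (hasSum_exp_series _) (E := fun i j => Real.exp (x i * y j))
    (fun i j => ?_) ?_
  · rw [abs_pow]
    exact pow_le_one₀ (abs_nonneg _) (abs_div_maxAbs_le_one hx i)
  · rw [abs_pow]
    exact pow_le_one₀ (abs_nonneg _) (abs_div_maxAbs_le_one hy j)
  · refine hasSum_of_forall_eq (fun k => ?_) (hasSum_exp_series (x i * y j))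
    rw [mul_pow, mul_pow, div_pow, div_pow]
    field_simp
  · exact ((exp_sub_sum_le hz.le (K + 1)).trans (pow_div_factorial_mul_exp_mono hz.le _)).trans
      htail

/-- The coefficients of the Chebyshev expansion. -/
noncomputable def chebyshevCoeff (z : ℝ) (k : ℕ) : ℝ :=
  (if k = 0 then 1 else 2) * (Real.exp z * (z / 2) ^ k / (k.factorial : ℝ))

/-- Adding the missing `exp z` at `k = 0` gives all terms the factor `2`, and the series becomes the
exponential series at `z / 2`. -/
theorem hasSum_chebyshevCoeff_succ (z : ℝ) :
    HasSum (fun k => chebyshevCoeff z k + if k = 0 then Real.exp z else 0)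
      (2 * Real.exp z * Real.exp (z / 2)) := by
  refine hasSum_of_forall_eq (fun k => ?_) ((hasSum_exp_series (z / 2)).mul_left (2 * Real.exp z))
  unfold chebyshevCoeff
  split_ifs with hk
  · subst hk
    simp
    ring
  · ring

theorem hasSum_chebyshevCoeff (z : ℝ) :
    HasSum (chebyshevCoeff z) (Real.exp z * (2 * Real.exp (z / 2) - 1)) := by
  have h := (hasSum_chebyshevCoeff_succ z).sub (hasSum_ite_eq 0 (Real.exp z))
  convert! h using 1
  · funext k
    rw [add_sub_cancel_right]
  · ring

/-- The factor `2` is absorbed by `(1 / 2) ^ m`, and `exp z * exp (z / 2) ≤ exp (2 * z)`. The same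
bound serves the Taylor tail, so one truncation order fits both cases. -/
theorem chebyshevCoeff_tail_le {z : ℝ} (hz : 0 < z) {m : ℕ} (hm : 2 ≤ m) :
    Real.exp z * (2 * Real.exp (z / 2) - 1) - ∑ k ∈ Finset.range m, chebyshevCoeff z k ≤
      z ^ m / (m.factorial : ℝ) * Real.exp (2 * z) := by
  have hs : ∑ k ∈ Finset.range m, chebyshevCoeff z k =
      2 * Real.exp z * ∑ k ∈ Finset.range m, (z / 2) ^ k / (k.factorial : ℝ) - Real.exp z := by
    have : ∀ k ∈ Finset.range m, chebyshevCoeff z k =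
        2 * Real.exp z * ((z / 2) ^ k / (k.factorial : ℝ)) - if k = 0 then Real.exp z else 0 := by
      intro k _
      unfold chebyshevCoeff
      split_ifs with hk
      · subst hk
        simp
        ring
      · ring
    rw [Finset.sum_congr rfl this, Finset.sum_sub_distrib, ← Finset.mul_sum,
      Finset.sum_ite_eq' (Finset.range m) 0, if_pos (Finset.mem_range.2 (by omega))]
  have h1 := exp_sub_sum_le (half_pos hz).le m
  have h2 := mul_le_mul_of_nonneg_left h1 (by positivity : 0 ≤ 2 * Real.exp z)
  have h3 : (2 : ℝ) * (1 / 2) ^ m ≤ 1 := by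
    have := pow_le_pow_of_le_one (by norm_num : (0 : ℝ) ≤ 1 / 2) (by norm_num) hm
    linarith
  have h4 : Real.exp z * Real.exp (z / 2) ≤ Real.exp (2 * z) := by
    rw [← Real.exp_add]
    exact Real.exp_le_exp.2 (by linarith)
  calc _ = 2 * Real.exp z * (Real.exp (z / 2) -
        ∑ k ∈ Finset.range m, (z / 2) ^ k / (k.factorial : ℝ)) := by rw [hs]; ring
    _ ≤ _ := h2
    _ = (2 * (1 / 2) ^ m) * (z ^ m / (m.factorial : ℝ)) * (Real.exp z * Real.exp (z / 2)) := by
        rw [div_pow, div_pow, one_pow]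
        ring
    _ ≤ 1 * (z ^ m / (m.factorial : ℝ)) * Real.exp (2 * z) := by gcongr
    _ = _ := by rw [one_mul]

theorem blockEncodable_chebyshev {n K : ℕ} (a : ℕ) {ε : ℝ} {x y : Fin (2 ^ n) → ℝ} (hn : 1 ≤ n)
    (hK : 1 ≤ K) (hx : 0 < maxAbs x) (hy : 0 < maxAbs y)
    (htail : (maxAbs x * maxAbs y) ^ (K + 1) / ((K + 1).factorial : ℝ) *
      Real.exp (2 * (maxAbs x * maxAbs y)) ≤ ε / 3) :
    BlockEncodableFromDiagonals a K
      (Real.exp (maxAbs x * maxAbs y) * (2 * Real.exp (maxAbs x * maxAbs y / 2) - 1)) ε 211 2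
      (besselDiag x y) (chebyshevDiag y) (qlt x y) := by
  have hz := mul_pos hx hy
  have hα : 0 < Real.exp (maxAbs x * maxAbs y) * (2 * Real.exp (maxAbs x * maxAbs y / 2) - 1) := by
    have := Real.one_lt_exp_iff.2 (half_pos hz)
    have := Real.exp_pos (maxAbs x * maxAbs y)
    exact mul_pos this (by linarith)
  have hb : ∀ k, 0 < besselBound x y k := fun k => by
    unfold besselBound
    positivity
  refine blockEncodable_of_expansion a hn hK hα
    (d := fun k i => besselI k (maxAbs y * x i) / besselBound x y k)
    (d' := fun k j => (Polynomial.Chebyshev.T ℝ (k : ℤ)).eval (y j / maxAbs y))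
    (fun k i => ?_) (fun k j => ?_) (c := chebyshevCoeff (maxAbs x * maxAbs y))
    (fun k => ?_) (hasSum_chebyshevCoeff _) (E := fun i j => Real.exp (x i * y j))
    (fun i j => ?_) ?_
  · rw [abs_div, abs_of_pos (hb k), div_le_one (hb k)]
    refine (abs_besselI_le k _).trans ?_
    have h : |maxAbs y * x i| ≤ maxAbs x * maxAbs y := by
      rw [abs_mul, abs_of_pos hy, mul_comm]
      exact mul_le_mul_of_nonneg_right (abs_le_maxAbs x i) hy.le
    calc (|maxAbs y * x i| / 2) ^ k / (k.factorial : ℝ) * Real.exp |maxAbs y * x i|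
        ≤ (maxAbs x * maxAbs y / 2) ^ k / (k.factorial : ℝ) * Real.exp (maxAbs x * maxAbs y) := by
          gcongr
      _ = besselBound x y k := by
          unfold besselBound
          ring
  · exact Polynomial.Chebyshev.abs_eval_T_real_le_one _ (abs_div_maxAbs_le_one hy j)
  · unfold chebyshevCoeff
    split_ifs <;> positivity
  -- Substituting `y j / maxAbs y = cos θ` turns `cos (k θ)` into the Chebyshev polynomial `T_k`,
  -- and the normalization `besselBound` cancels against `chebyshevCoeff`.
  · have hj := abs_le.1 (abs_div_maxAbs_le_one hy j)
    have hcos := Real.cos_arccos hj.1 hj.2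
    have h := hasSum_jacobi_anger (maxAbs y * x i) (Real.arccos (y j / maxAbs y))
    have e : maxAbs y * x i * (y j / maxAbs y) = x i * y j := by field_simp
    rw [hcos, e] at h
    refine hasSum_of_forall_eq (fun k => ?_) h
    have hT := Polynomial.Chebyshev.T_real_cos (Real.arccos (y j / maxAbs y)) (k : ℤ)
    rw [hcos, Int.cast_natCast] at hT
    have hbk := (hb k).ne'
    have hc : chebyshevCoeff (maxAbs x * maxAbs y) k = (if k = 0 then 1 else 2) *
        besselBound x y k := rfl
    rw [← hT, hc, mul_assoc _ (besselBound x y k), mul_div_cancel₀ _ hbk]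
  · exact (chebyshevCoeff_tail_le hz (by omega)).trans htail

theorem mainTheorem1 :
    ∃ (c₁ c₂ C : ℝ) (p : ℕ), 0 < c₁ ∧ 0 < c₂ ∧ 0 < C ∧
      ∀ (n a : ℕ) (ε : ℝ) (x y : Fin (2 ^ n) → ℝ),
        1 ≤ n → 0 < ε → ε < 1 → 0 < maxAbs x → 0 < maxAbs y →
        -- Taylor expansion
        (∃ K : ℕ, 1 ≤ K ∧ c₁ * truncationScale x y ε ≤ K ∧ K ≤ c₂ * truncationScale x y ε + 1 ∧
          BlockEncodableFromDiagonals a K (Real.exp (maxAbs x * maxAbs y)) ε C p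
            (powerDiag x) (powerDiag y) (qlt x y)) ∧
        -- Chebyshev expansion
        (∃ K : ℕ, 1 ≤ K ∧ c₁ * truncationScale x y ε ≤ K ∧ K ≤ c₂ * truncationScale x y ε + 1 ∧
          BlockEncodableFromDiagonals a K
            (Real.exp (maxAbs x * maxAbs y) * (2 * Real.exp (maxAbs x * maxAbs y / 2) - 1)) ε C p
            (besselDiag x y) (chebyshevDiag y) (qlt x y)) := by
  refine ⟨1, 16, 211, 2, one_pos, by norm_num, by norm_num, fun n a ε x y hn hε hε1 hx hy => ?_⟩
  have hz := mul_pos hx hy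
  have hE : 0 ≤ truncationScale x y ε := by
    have hL : 0 ≤ Real.log (1 / ε) := Real.log_nonneg (by rw [le_div_iff₀ hε]; linarith)
    have hlog : 0 ≤ Real.log (Real.exp 1 + Real.log (1 / ε) / (maxAbs x * maxAbs y)) :=
      Real.log_nonneg (by linarith [Real.exp_one_gt_d9, div_nonneg hL hz.le])
    exact add_nonneg hz.le (div_nonneg hL hlog)
  have hlt := Nat.lt_floor_add_one (16 * truncationScale x y ε)
  have hle := Nat.floor_le (by positivity : 0 ≤ 16 * truncationScale x y ε)
  have htail := tail_le_of_truncation hz hε hε1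
    (m := ⌊16 * truncationScale x y ε⌋₊ + 1 + 1) (by omega) (by
      have h : 16 * truncationScale x y ε ≤
          ((⌊16 * truncationScale x y ε⌋₊ + 1 + 1 : ℕ) : ℝ) := by
        push_cast
        linarith
      exact h)
  refine ⟨⟨_, Nat.le_add_left 1 _, ?_, ?_, blockEncodable_taylor a hn (Nat.le_add_left 1 _)
      hx hy htail⟩,
    ⟨_, Nat.le_add_left 1 _, ?_, ?_, blockEncodable_chebyshev a hn (Nat.le_add_left 1 _)
      hx hy htail⟩⟩ <;> push_cast <;> linarith
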